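/- Let $K$ be a field. Let $\mathcal B(K)$ be the set of all $\mathcal O\subseteq K$ with $\mathcal O\cdot\mathcal O\subseteq\mathcal O$ and $\mathcal O\cup\mathcal O^{-1}=K$, where $X^{-1}=\{x^{-1}:0\ne x\in X\}$, and put $\mathcal O^\times=\mathcal O\cap\mathcal O^{-1}$, $\mathfrak m_{\mathcal O}=\mathcal O\setminus\mathcal O^\times$. A \emph{locality} $v$ of $K$ is an equivalence class of Krull valuations on $K$, or an ordering of $K$, or an equivalence class of absolute values on $K$; it is identified with its unit ball $\mathcal O_v\in\mathcal B(K)$, which is respectively the valuation ring $\{v(x)\ge 0\}$, the interval $\{-1\le_v x\le_v 1\}$, or $\{|x|_v\le 1\}$. Write $\mathfrak m_v=\mathfrak m_{\mathcal O_v}$ and let ${\rm S}(K)\subseteq\mathcal B(K)$ be the set of localities; the trivial valuation corresponds to $\mathcal O=K$. The \emph{constructible topology} on ${\rm S}(K)$ has the subbasis of all sets $\{v:x\in\mathcal O_v\}$ and $\{v:x\in\mathfrak m_v\}$, $x\in K$, and the topology $\mathcal T_{\rm Zar^*}$ has the subbasis of all sets $\{v:x\in\mathfrak m_v\}$, $x\in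 K$. (Compact does not include Hausdorff.) The \emph{$v$-topology} on $K$ is the translation-invariant topology for which the sets $z\mathfrak m_v$, $z\in K^\times$, are a basis of neighbourhoods of $0$; two localities are \emph{independent} if they induce distinct topologies. For nonempty $S\subseteq{\rm S}(K)$ put $\mathfrak m_S=\bigcap_{v\in S}\mathfrak m_v$; the \emph{$S$-topology} on $K$ is the translation-invariant topology whose filter of neighbourhoods of $0$ is generated by the sets $z\mathfrak m_S$, $0\ne z\in\mathfrak m_S$. Powers $K^l$, $K^m$ carry the product topologies. For $\underline y\in K^m$, $\underline z\in(K^\times)^m$ put ${\rm B}_v(\underline y,\underline z)=\prod_{j=1}^m(y_j+z_j\mathfrak m_v)$. A map $g:D\to K^m$ with $D\subseteq K^l$ is \emph{$S$-hereditarily continuous} if it is continuous for the $S'$-topologies for every nonempty $\mathcal T_{\rm Zar^*}$-compact $S'\subseteq S$. Theorem. Let $n\ge 1$, let $S_1,\dots,S_n\subseteq{\rm S}(K)\setminus\{v_{\rm trivial}\}$ be nonempty and pairwise disjoint, and let $t\in K^\times$, $\underline y_1,\dots,\underline y_n\in K^m$, $\underline z_1,\dots,\underline z_n\in(K^\times)^m$.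 Assume: (U) There is a polynomial $f\in K[X]$ of degree $d\ge 2$ with leading coefficient $a_d$ such that for every $i$ and every $v\in S_i$: $f(x)\in\mathcal O_v$ for all $x\in\mathcal O_v$; $f(x)\in x^d(\mathcal O_v\setminus t\mathfrak m_v)\cap(a_dx^d+x^{d-1}\mathcal O_v)$ for all $x\in K\setminus\mathcal O_v$; $\mathcal O_v+\mathcal O_v\subseteq t^{-1}\mathcal O_v$; and, if $S_i$ is infinite, also $f(x)\notin t\mathfrak m_v$ for all $x\in\mathcal O_v$. (T) Each $S_i$ is compact in the constructible topology. (I) Any two distinct elements of $S=S_1\cup\dots\cup S_n$ are independent. Let $D\subseteq K^l$ be $v$-open for all $v\in S$, and let $g:D\to K^m$ be $S_i$-hereditarily continuous for all $i$. Suppose that for each $i$ and each $v\in S_i$ there is some $\underline x_v\in D$ with $g(\underline x_v)\in{\rm B}_v(\underline y_i,\underline z_i)$. Then there is $\underline x\in D$ with $g(\underline x)\in{\rm B}_v(\underline y_i,\underline z_i)$ for every $i$ and every $v\in S_i$. -/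

import Mathlib

open Set Filter Polynomial
open scoped Pointwise Topology

universe u

/-- `X⁻¹ = {x⁻¹ : 0 ≠ x ∈ X}` for a subset `X` of a field. -/
def nonzeroInv {K : Type u} [Field K] (X : Set K) : Set K :=
  {y | ∃ x ∈ X, x ≠ 0 ∧ y = x⁻¹}

/-- The set `𝓑(K)` of all `O ⊆ K` with `O · O ⊆ O` and `O ∪ O⁻¹ = K`. -/
@[ext]
structure UnitBall (K : Type u) [Field K] where
  carrier : Set K
  mul_subset : carrier * carrier ⊆ carrier
  union_inv : carrier ∪ nonzeroInv carrier = univ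

namespace UnitBall

variable {K : Type u} [Field K]

/-- The two conditions on `O`, written out elementwise. -/
def mk' (O : Set K) (h0 : (0 : K) ∈ O) (hmul : ∀ x ∈ O, ∀ y ∈ O, x * y ∈ O)
    (hinv : ∀ x, x ≠ 0 → x ∉ O → x⁻¹ ∈ O) : UnitBall K where
  carrier := O
  mul_subset := by
    rintro _ ⟨x, hx, y, hy, rfl⟩
    exact hmul x hx y hy
  union_inv := by
    refine eq_univ_of_forall fun x => ?_
    by_cases hx : x ∈ O
    · exact Or.inl hx
    · have hx0 : x ≠ 0 := fun h => hx (h ▸ h0)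
      exact Or.inr ⟨x⁻¹, hinv x hx0 hx, inv_ne_zero hx0, (inv_inv x).symm⟩

/-- `O^× = O ∩ O⁻¹`. -/
def units (O : UnitBall K) : Set K := O.carrier ∩ nonzeroInv O.carrier

/-- `𝔪_O = O \ O^×`. -/
def maximal (O : UnitBall K) : Set K := O.carrier \ O.units

theorem mem_maximal_iff (O : UnitBall K) (x : K) :
    x ∈ O.maximal ↔ x ∈ O.carrier ∧ (x = 0 ∨ x⁻¹ ∉ O.carrier) := by
  have key : x ∈ nonzeroInv O.carrier ↔ x ≠ 0 ∧ x⁻¹ ∈ O.carrier := by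
    constructor
    · rintro ⟨y, hy, hy0, rfl⟩
      exact ⟨inv_ne_zero hy0, by rwa [inv_inv]⟩
    · rintro ⟨h0, hx⟩
      exact ⟨x⁻¹, hx, inv_ne_zero h0, (inv_inv x).symm⟩
  unfold maximal units
  rw [Set.mem_sdiff, mem_inter_iff, key]
  tauto

variable (K)

/-- The constructible topology on `𝓑(K)`, with subbasis `{O : x ∈ O}`, `{O : x ∈ 𝔪_O}`, `x ∈ K`. -/
abbrev constructibleTopology : TopologicalSpace (UnitBall K) :=
  TopologicalSpace.generateFrom
    (range (fun x : K => {O : UnitBall K | x ∈ O.carrier}) ∪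
      range (fun x : K => {O : UnitBall K | x ∈ O.maximal}))

/-- The Hochster dual of the Zariski topology on `𝓑(K)`, with subbasis `{O : x ∈ 𝔪_O}`, `x ∈ K`. -/
abbrev zariskiDualTopology : TopologicalSpace (UnitBall K) :=
  TopologicalSpace.generateFrom (range (fun x : K => {O : UnitBall K | x ∈ O.maximal}))

variable {K}

/-- The unit ball `O_v` of (the equivalence class of) a Krull valuation: its valuation ring. -/
def ofValuationSubring (A : ValuationSubring K) : UnitBall K :=
  mk' (A : Set K) A.zero_mem (fun x hx y hy => A.mul_mem x y hx hy)
    (fun x _ hx => (A.mem_or_inv_mem x).resolve_left hx)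

/-- The unit ball `{x : -1 ≤ x ≤ 1}` of an ordering of the field `K`. -/
def ofOrdering (L : LinearOrder K) (_ : IsStrictOrderedRing K) : UnitBall K :=
  mk' {x | -1 ≤ x ∧ x ≤ 1}
    ⟨by simp, by simp⟩
    (fun x hx y hy => by
      have hx' : |x| ≤ 1 := abs_le.2 hx
      have hy' : |y| ≤ 1 := abs_le.2 hy
      refine abs_le.1 ?_
      rw [abs_mul]
      exact mul_le_one₀ hx' (abs_nonneg y) hy')
    (fun x _ hx => by
      refine abs_le.1 ?_
      have hx' : ¬ |x| ≤ 1 := fun h => hx (abs_le.1 h)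
      rw [abs_inv]
      exact inv_le_one_of_one_le₀ (le_of_lt (not_le.1 hx')))

/-- The unit ball `{x : |x| ≤ 1}` of a (real-valued) absolute value on `K`. -/
def ofAbsoluteValue (a : AbsoluteValue K ℝ) : UnitBall K :=
  mk' {x | a x ≤ 1}
    (by simp)
    (fun x hx y hy => by
      simp only [mem_ofPred_eq, map_mul] at *
      exact mul_le_one₀ hx (a.nonneg y) hy)
    (fun x _ hx => by
      simp only [mem_ofPred_eq, not_le, map_inv₀] at *
      exact inv_le_one_of_one_le₀ hx.le)

/-- The elements of `𝓑(K)` that come from a valuation, an ordering or an absolute value. -/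
def IsLocality (O : UnitBall K) : Prop :=
  (∃ A : ValuationSubring K, O = ofValuationSubring A) ∨
  (∃ (L : LinearOrder K) (h : IsStrictOrderedRing K), O = ofOrdering L h) ∨
  (∃ a : AbsoluteValue K ℝ, O = ofAbsoluteValue a)

theorem mem_maximal_ofValuation {Γ : Type*} [LinearOrderedCommGroupWithZero Γ]
    (v : Valuation K Γ) (x : K) :
    x ∈ (ofValuationSubring v.valuationSubring).maximal ↔ v x < 1 := by
  have hc : ∀ y, y ∈ (ofValuationSubring v.valuationSubring).carrier ↔ v y ≤ 1 :=
    fun y => v.mem_valuationSubring_iff y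
  rw [mem_maximal_iff, hc, hc]
  by_cases h0 : x = 0
  · simp [h0]
  · have hpos : 0 < v x := zero_lt_iff.2 ((Valuation.ne_zero_iff v).2 h0)
    rw [map_inv₀, inv_le_one₀ hpos]
    simp only [h0, false_or, not_le]
    exact ⟨fun h => h.2, fun h => ⟨h.le, h⟩⟩

theorem mem_maximal_ofOrdering (L : LinearOrder K) (h : IsStrictOrderedRing K) (x : K) :
    x ∈ (ofOrdering L h).maximal ↔ -1 < x ∧ x < 1 := by
  have hc : ∀ y, y ∈ (ofOrdering L h).carrier ↔ |y| ≤ 1 := fun y => abs_le.symm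
  rw [mem_maximal_iff, hc, hc, ← abs_lt]
  by_cases h0 : x = 0
  · simp [h0]
  · rw [abs_inv, inv_le_one₀ (abs_pos.2 h0)]
    simp only [h0, false_or, not_le]
    exact ⟨fun h => h.2, fun h => ⟨h.le, h⟩⟩

theorem mem_maximal_ofAbsoluteValue (a : AbsoluteValue K ℝ) (x : K) :
    x ∈ (ofAbsoluteValue a).maximal ↔ a x < 1 := by
  have hc : ∀ y, y ∈ (ofAbsoluteValue a).carrier ↔ a y ≤ 1 := fun y => Iff.rfl
  rw [mem_maximal_iff, hc, hc]
  by_cases h0 : x = 0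
  · simp [h0]
  · rw [map_inv₀, inv_le_one₀ (a.pos h0)]
    simp only [h0, false_or, not_le]
    exact ⟨fun h => h.2, fun h => ⟨h.le, h⟩⟩

end UnitBall

/-- The space `S(K)` of localities of `K`: equivalence classes of valuations, orderings, and
equivalence classes of absolute values, each identified with its unit ball `O_v ∈ 𝓑(K)`. -/
def Locality (K : Type u) [Field K] : Type u := {O : UnitBall K // O.IsLocality}

namespace Locality

variable {K : Type u} [Field K]

/-- `O_v`. -/
def ball (v : Locality K) : Set K := v.1.carrier

/-- `𝔪_v`. -/
def maximal (v : Locality K) : Set K := v.1.maximal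

variable (K)

/-- The trivial valuation. -/
def trivial : Locality K := ⟨UnitBall.ofValuationSubring ⊤, Or.inl ⟨⊤, rfl⟩⟩

abbrev constructibleTopology : TopologicalSpace (Locality K) :=
  (UnitBall.constructibleTopology K).induced Subtype.val

abbrev zariskiDualTopology : TopologicalSpace (Locality K) :=
  (UnitBall.zariskiDualTopology K).induced Subtype.val

variable {K}

/-- The translation invariant topology on `K` in which `N` is the filter of neighbourhoods of `0`:
a set `U` is open iff `U ∈ x + N` for every `x ∈ U`. -/
abbrev translationTopology (N : Filter K) : TopologicalSpace K :=
  TopologicalSpace.mkOfNhds (fun x => N.map (fun y => x + y))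

/-- The `v`-topology on `K`: the sets `z 𝔪_v`, `z ∈ K^×`, are a basis for the filter of
neighbourhoods of `0`. -/
abbrev topology (v : Locality K) : TopologicalSpace K :=
  translationTopology (⨅ z ∈ {z : K | z ≠ 0}, 𝓟 (z • v.maximal))

/-- Two localities are independent if they induce distinct topologies on `K`. -/
def Independent (v w : Locality K) : Prop := v.topology ≠ w.topology

/-- `𝔪_S = ⋂_{v ∈ S} 𝔪_v`, for nonempty `S`. -/
def maximalOf (S : Set (Locality K)) : Set K := ⋂ v ∈ S, v.maximal

/-- The `S`-topology on `K`: the sets `z 𝔪_S`, `0 ≠ z ∈ 𝔪_S`, generate the filter of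
neighbourhoods of `0`. -/
abbrev topologyOf (S : Set (Locality K)) : TopologicalSpace K :=
  translationTopology (⨅ z ∈ maximalOf S \ {0}, 𝓟 (z • maximalOf S))

/-- The `S`-ball `B_S(x, z) = ∏ⱼ (xⱼ + zⱼ 𝔪_S)` in `K ^ m`. -/
def ballOf (S : Set (Locality K)) {m : ℕ} (x z : Fin m → K) : Set (Fin m → K) :=
  univ.pi (fun j => {x j} + z j • maximalOf S)

/-- The `v`-ball `B_v(x, z) = ∏ⱼ (xⱼ + zⱼ 𝔪_v)` in `K ^ m`. -/
def ballAt (v : Locality K) {m : ℕ} (x z : Fin m → K) : Set (Fin m → K) :=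
  ballOf {v} x z

/-- A subset of `K ^ l` is `v`-open if it is open in the product of the `v`-topologies. -/
def IsOpenAt (v : Locality K) {l : ℕ} (D : Set (Fin l → K)) : Prop :=
  IsOpen[@Pi.topologicalSpace (Fin l) (fun _ => K) (fun _ => v.topology)] D

/-- Continuity of `g : D → K ^ m`, `D ⊆ K ^ l`, for the (products of the) `S`-topologies. -/
def ContinuousFor (S : Set (Locality K)) {l m : ℕ} {D : Set (Fin l → K)}
    (g : D → (Fin m → K)) : Prop :=
  Continuous[(@Pi.topologicalSpace (Fin l) (fun _ => K) (fun _ => topologyOf S)).induced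
      Subtype.val,
    @Pi.topologicalSpace (Fin m) (fun _ => K) (fun _ => topologyOf S)] g

/-- `g` is `S`-hereditarily continuous: it is `S'`-continuous for every nonempty `S' ⊆ S` that is
compact in the Hochster dual of the Zariski topology. -/
def HereditarilyContinuous (S : Set (Locality K)) {l m : ℕ} {D : Set (Fin l → K)}
    (g : D → (Fin m → K)) : Prop :=
  ∀ S' ⊆ S, S'.Nonempty → @IsCompact _ (zariskiDualTopology K) S' → ContinuousFor S' g

/-- `f(x) ∈ O_v` for all `x ∈ O_v`. -/
def CondIntegral (f : K[X]) (v : Locality K) : Prop :=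
  ∀ x ∈ v.ball, f.eval x ∈ v.ball

/-- `f(x) ∉ t 𝔪_v` for all `x ∈ O_v`. -/
def CondNoApproxZero (f : K[X]) (t : K) (v : Locality K) : Prop :=
  ∀ x ∈ v.ball, f.eval x ∉ t • v.maximal

/-- `f(x) ∈ x^d (O_v \ t 𝔪_v) ∩ (a_d x^d + x^(d-1) O_v)` for all `x ∉ O_v`. -/
def CondLeadingTerm (f : K[X]) (t : K) (v : Locality K) : Prop :=
  ∀ x ∉ v.ball, f.eval x ∈
    x ^ f.natDegree • (v.ball \ t • v.maximal) ∩
      ({f.leadingCoeff * x ^ f.natDegree} + x ^ (f.natDegree - 1) • v.ball)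

/-- `O_v + O_v ⊆ t⁻¹ O_v`. -/
def CondPlus (t : K) (v : Locality K) : Prop :=
  v.ball + v.ball ⊆ t⁻¹ • v.ball

/-- The uniformity assumption on finitely many sets `S_1, …, S_n` of localities and `t ∈ K^×`:
one polynomial of degree at least two for all the `S_i`, where `CondNoApproxZero` is only required
on the infinite ones. -/
def UniformityAssumption {n : ℕ} (S : Fin n → Set (Locality K)) (t : K) : Prop :=
  ∃ f : K[X], 2 ≤ f.natDegree ∧ ∀ i, ∀ v ∈ S i,
    CondIntegral f v ∧ CondLeadingTerm f t v ∧ CondPlus t v ∧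
      ((S i).Infinite → CondNoApproxZero f t v)

end Locality

/-! ### Multiplicative size functions attached to elements of 𝓑(K) -/

namespace UnitBall

variable {K : Type u} [Field K] (O : UnitBall K)

/-! Write |·| for the multiplicative `size` with values in `K^×/O_v^× ∪ {0}`; it exists for every
locality, and `CondPlus` supplies the ultrametric inequality up to a factor |t|. Approximation is
expressed by finite sets of thresholds, through `Large` and `Small`.

The engine is the operation `F(x,y) = y^d f(x/y)` (`homogEval`). It preserves smallness, and once
`t⁻¹` is among the thresholds, |F(x,y)| is at least max(|x|,|y|) wherever `f` has no approximate
zero in `O_v`, or |y| < |x|. Largeness is an open condition in the constructible topology, so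
compactness and finitely many uses of F merge elements large at single localities into one that is
large on a whole set (`exists_large_of_forall`). Applied twice, starting from weak approximation at
finitely many independent localities, this gives an `x` large on A and small on B
(`exists_large_small`). Then `x/(1+x)` is near 1 on A and near 0 on B, and linear combinations of
such elements give `exists_approximation`.

For the theorem, each `S_i` is cut into finitely many compact pieces, each served by one point of
`D`. If the target ball of a piece is open, continuity of `g` turns "close to that point on the
piece" into finitely many thresholds, and one `x` approximates all these points. Openness of the
balls (`UniformlyOpen`) is checked one locality at a time on finite pieces. For infinite `S_i`
thresholds uniform in `v` are needed: `(1 ± a)⁻¹` serve all valuations, orderings and real absolute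
values, while complex ones cannot occur, since `f` has a root in ℂ and `K` is dense there. -/

theorem mul_mem {x y : K} (hx : x ∈ O.carrier) (hy : y ∈ O.carrier) : x * y ∈ O.carrier :=
  O.mul_subset (Set.mul_mem_mul hx hy)

theorem mem_or_inv_mem {x : K} (_ : x ≠ 0) : x ∈ O.carrier ∨ x⁻¹ ∈ O.carrier := by
  have h : x ∈ O.carrier ∪ nonzeroInv O.carrier := by rw [O.union_inv]; trivial
  rcases h with h | ⟨y, hy, -, rfl⟩
  · exact Or.inl h
  · exact Or.inr (by rwa [inv_inv])

theorem zero_mem : (0 : K) ∈ O.carrier := by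
  have h : (0 : K) ∈ O.carrier ∪ nonzeroInv O.carrier := by rw [O.union_inv]; trivial
  rcases h with h | ⟨y, -, hy0, hy⟩
  · exact h
  · exact absurd hy.symm (inv_ne_zero hy0)

theorem one_mem : (1 : K) ∈ O.carrier := by
  rcases O.mem_or_inv_mem one_ne_zero with h | h
  · exact h
  · rwa [inv_one] at h

/-- The elements of `O^×` as a subgroup of `K^×`. -/
def unitSubgroup : Subgroup Kˣ where
  carrier := {a | (a : K) ∈ O.carrier ∧ ((a⁻¹ : Kˣ) : K) ∈ O.carrier}
  one_mem' := by simpa using O.one_mem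
  mul_mem' := by
    rintro a b ⟨ha, ha'⟩ ⟨hb, hb'⟩
    refine ⟨by rw [Units.val_mul]; exact O.mul_mem ha hb, ?_⟩
    rw [mul_inv, Units.val_mul]
    exact O.mul_mem ha' hb'
  inv_mem' := by
    rintro a ⟨ha, ha'⟩
    exact ⟨ha', by rwa [inv_inv]⟩

theorem mem_unitSubgroup {a : Kˣ} :
    a ∈ O.unitSubgroup ↔ (a : K) ∈ O.carrier ∧ ((a⁻¹ : Kˣ) : K) ∈ O.carrier := Iff.rfl

/-- The value group `K^× / O^×`. -/
def ValueGroup : Type u := Kˣ ⧸ O.unitSubgroup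

instance : CommGroup O.ValueGroup := inferInstanceAs (CommGroup (Kˣ ⧸ O.unitSubgroup))

/-- The projection `K^× → K^× / O^×`. -/
def toValueGroup : Kˣ →* O.ValueGroup := QuotientGroup.mk' O.unitSubgroup

theorem toValueGroup_surjective : Function.Surjective O.toValueGroup :=
  QuotientGroup.mk'_surjective _

theorem toValueGroup_eq_iff {a b : Kˣ} :
    O.toValueGroup a = O.toValueGroup b ↔ a⁻¹ * b ∈ O.unitSubgroup :=
  QuotientGroup.eq

instance : LE O.ValueGroup where
  le x y := ∃ a b : Kˣ, O.toValueGroup a = x ∧ O.toValueGroup b = y ∧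
    ((b⁻¹ * a : Kˣ) : K) ∈ O.carrier

theorem toValueGroup_le_iff {a b : Kˣ} :
    O.toValueGroup a ≤ O.toValueGroup b ↔ ((b⁻¹ * a : Kˣ) : K) ∈ O.carrier := by
  constructor
  · rintro ⟨a', b', ha, hb, h⟩
    rw [toValueGroup_eq_iff] at ha hb
    have : (b⁻¹ * a : Kˣ) = (b'⁻¹ * b)⁻¹ * (b'⁻¹ * a') * (a'⁻¹ * a) := by group
    rw [this, Units.val_mul, Units.val_mul]
    exact O.mul_mem (O.mul_mem hb.2 h) ha.1
  · exact fun h => ⟨a, b, rfl, rfl, h⟩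

-- Transitivity comes from `O · O ⊆ O`, totality from `O ∪ O⁻¹ = K`, antisymmetry from dividing out
-- `O^×`. Addition plays no role, so the three kinds of localities are treated alike.
open Classical in
noncomputable instance : LinearOrder O.ValueGroup where
  le_refl x := by
    obtain ⟨a, rfl⟩ := O.toValueGroup_surjective x
    simpa [toValueGroup_le_iff] using O.one_mem
  le_trans x y z := by
    obtain ⟨a, rfl⟩ := O.toValueGroup_surjective x
    obtain ⟨b, rfl⟩ := O.toValueGroup_surjective y
    obtain ⟨c, rfl⟩ := O.toValueGroup_surjective z
    simp only [toValueGroup_le_iff]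
    intro h1 h2
    have : c⁻¹ * a = (c⁻¹ * b) * (b⁻¹ * a) := by group
    rw [this, Units.val_mul]
    exact O.mul_mem h2 h1
  le_antisymm x y := by
    obtain ⟨a, rfl⟩ := O.toValueGroup_surjective x
    obtain ⟨b, rfl⟩ := O.toValueGroup_surjective y
    simp only [toValueGroup_le_iff, toValueGroup_eq_iff, mem_unitSubgroup]
    intro h1 h2
    exact ⟨h2, by rwa [mul_inv_rev, inv_inv]⟩
  le_total x y := by
    obtain ⟨a, rfl⟩ := O.toValueGroup_surjective x
    obtain ⟨b, rfl⟩ := O.toValueGroup_surjective y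
    simp only [toValueGroup_le_iff]
    rcases O.mem_or_inv_mem (b⁻¹ * a).ne_zero with h | h
    · exact Or.inl h
    · rw [← Units.val_inv_eq_inv_val, mul_inv_rev, inv_inv] at h
      exact Or.inr h
  toDecidableLE := Classical.decRel _

instance : IsOrderedMonoid O.ValueGroup where
  mul_le_mul_left x y h z := by
    obtain ⟨a, rfl⟩ := O.toValueGroup_surjective x
    obtain ⟨b, rfl⟩ := O.toValueGroup_surjective y
    obtain ⟨c, rfl⟩ := O.toValueGroup_surjective z
    rw [← map_mul, ← map_mul]
    rw [toValueGroup_le_iff] at h ⊢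
    convert h using 2
    rw [mul_comm a c, mul_comm b c]
    group

open Classical in
/-- The multiplicative size function `K → K^× / O^× ∪ {0}` whose unit ball is `O`. -/
noncomputable def size : K →*₀ WithZero O.ValueGroup where
  toFun x := if h : x = 0 then 0 else (O.toValueGroup (Units.mk0 x h) : WithZero O.ValueGroup)
  map_zero' := by simp
  map_one' := by
    rw [dif_neg one_ne_zero, Units.mk0_one, map_one, WithZero.coe_one]
  map_mul' x y := by
    by_cases hx : x = 0
    · simp [hx]
    by_cases hy : y = 0
    · simp [hy]
    rw [dif_neg hx, dif_neg hy, dif_neg (mul_ne_zero hx hy), Units.mk0_mul, map_mul,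
      WithZero.coe_mul]

theorem size_apply {x : K} (hx : x ≠ 0) :
    O.size x = (O.toValueGroup (Units.mk0 x hx) : WithZero O.ValueGroup) := dif_neg hx

theorem size_le_one_iff (x : K) : O.size x ≤ 1 ↔ x ∈ O.carrier := by
  by_cases hx : x = 0
  · simp [hx, O.zero_mem]
  · rw [size_apply O hx, ← WithZero.coe_one, WithZero.coe_le_coe, ← map_one O.toValueGroup,
      toValueGroup_le_iff]
    simp

theorem size_lt_one_iff (x : K) : O.size x < 1 ↔ x ∈ O.maximal := by
  rw [mem_maximal_iff, ← size_le_one_iff, ← size_le_one_iff, map_inv₀]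
  by_cases hx : x = 0
  · simp [hx]
  · have hpos : 0 < O.size x := zero_lt_iff.2 ((_root_.map_ne_zero _).2 hx)
    rw [inv_le_one₀ hpos, not_le]
    simp only [hx, false_or]
    exact ⟨fun h => ⟨h.le, h⟩, fun h => h.2⟩

end UnitBall

/-! ### Quasi-ultrametric inequalities and the homogenized polynomial -/

namespace Locality

variable {K : Type u} [Field K]

/-- The unit ball of a locality, as an element of `𝓑(K)`. -/
def toUnitBall (v : Locality K) : UnitBall K := v.1

/-- The size function of a locality, with values in `K^× / O_v^× ∪ {0}`. -/
noncomputable def size (v : Locality K) : K →*₀ WithZero v.toUnitBall.ValueGroup :=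
  v.toUnitBall.size

theorem mem_ball_iff {v : Locality K} {x : K} : x ∈ v.ball ↔ v.size x ≤ 1 :=
  (v.toUnitBall.size_le_one_iff x).symm

theorem mem_maximal_iff {v : Locality K} {x : K} : x ∈ v.maximal ↔ v.size x < 1 :=
  (v.toUnitBall.size_lt_one_iff x).symm

theorem size_ne_zero {v : Locality K} {x : K} : v.size x ≠ 0 ↔ x ≠ 0 := _root_.map_ne_zero _

theorem size_pos {v : Locality K} {x : K} : 0 < v.size x ↔ x ≠ 0 :=
  zero_lt_iff.trans size_ne_zero

/-- The square of |-1| is 1, and a totally ordered group has no torsion. -/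
theorem size_neg (v : Locality K) (x : K) : v.size (-x) = v.size x := by
  have h : v.size (-1) = 1 := by
    have h2 : v.size (-1) ^ 2 = 1 := by rw [← map_pow]; simp
    exact (pow_eq_one_iff_of_nonneg zero_le two_ne_zero).1 h2
  rw [← neg_one_mul, map_mul, h, one_mul]

theorem mem_smul_ball_iff {v : Locality K} {x c : K} (hc : c ≠ 0) :
    x ∈ c • v.ball ↔ v.size x ≤ v.size c := by
  rw [Set.mem_smul_set_iff_inv_smul_mem₀ hc, mem_ball_iff, smul_eq_mul, map_mul, map_inv₀,
    inv_mul_le_iff₀ (size_pos.2 hc), mul_one]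

theorem mem_smul_maximal_iff {v : Locality K} {x c : K} (hc : c ≠ 0) :
    x ∈ c • v.maximal ↔ v.size x < v.size c := by
  rw [Set.mem_smul_set_iff_inv_smul_mem₀ hc, mem_maximal_iff, smul_eq_mul, map_mul, map_inv₀,
    inv_mul_lt_iff₀ (size_pos.2 hc), mul_one]

theorem mem_maximalOf_iff {S : Set (Locality K)} {x : K} :
    x ∈ maximalOf S ↔ ∀ v ∈ S, v.size x < 1 := by
  simp only [maximalOf, mem_iInter, mem_maximal_iff]

theorem CondPlus.size_add_le {t : K} {v : Locality K} (ht : t ≠ 0) (h : CondPlus t v) (a b : K) :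
    v.size t * v.size (a + b) ≤ max (v.size a) (v.size b) := by
  wlog hab : v.size b ≤ v.size a generalizing a b
  · rw [add_comm, max_comm]
    exact this b a (le_of_not_ge hab)
  rw [max_eq_left hab]
  by_cases ha : a = 0
  · have hb : b = 0 := by simpa [ha] using hab
    simp [ha, hb]
  have hpos := (size_pos (v := v)).2 ha
  have key : a / a + b / a ∈ t⁻¹ • v.ball := by
    refine h (Set.add_mem_add ?_ ?_)
    · rw [mem_ball_iff, div_self ha, map_one]
    · rw [mem_ball_iff, map_div₀]
      exact div_le_one_of_le₀ hab hpos.le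
  rw [mem_smul_ball_iff (inv_ne_zero ht), ← add_div, map_div₀, map_inv₀, div_le_iff₀ hpos] at key
  calc v.size t * v.size (a + b) ≤ v.size t * ((v.size t)⁻¹ * v.size a) := by gcongr
    _ = v.size a := mul_inv_cancel_left₀ (size_ne_zero.2 ht) _

theorem CondPlus.size_le_one {t : K} {v : Locality K} (ht : t ≠ 0) (h : CondPlus t v) :
    v.size t ≤ 1 := by
  simpa using h.size_add_le ht 1 0

theorem CondPlus.size_sub_le {t : K} {v : Locality K} (ht : t ≠ 0) (h : CondPlus t v) (a b : K) :
    v.size t * v.size (a - b) ≤ max (v.size a) (v.size b) := by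
  simpa [sub_eq_add_neg, size_neg] using h.size_add_le ht a (-b)

/-- A sum is not much smaller than its first term if the second term is much smaller. -/
theorem CondPlus.le_size_add {t : K} {v : Locality K} (ht : t ≠ 0) (h : CondPlus t v) {a b : K}
    (hab : v.size b < v.size t * v.size a) : v.size t * v.size a ≤ v.size (a + b) := by
  have := h.size_sub_le ht (a + b) b
  rw [add_sub_cancel_right] at this
  rcases le_max_iff.1 this with h1 | h1
  · exact h1
  · exact absurd hab (not_lt.2 h1)

/-- Each addition costs one factor |t|, so a bound with one such factor per summand suffices. -/
theorem CondPlus.size_sum_lt {t : K} {v : Locality K} (ht : t ≠ 0) (h : CondPlus t v)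
    {ι : Type*} (s : Finset ι) (a : ι → K) (γ : WithZero v.toUnitBall.ValueGroup) (hγ : 0 < γ)
    (ha : ∀ i ∈ s, v.size (a i) < v.size t ^ s.card * γ) : v.size (∑ i ∈ s, a i) < γ := by
  classical
  induction s using Finset.induction_on generalizing γ with
  | empty => simpa using hγ
  | insert i s hi ih =>
    have htpos := (size_pos (v := v)).2 ht
    rw [Finset.sum_insert hi]
    rw [Finset.card_insert_of_notMem hi] at ha
    have h1 : v.size (∑ j ∈ s, a j) < v.size t * γ := by
      refine ih _ (mul_pos htpos hγ) fun j hj => ?_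
      have := ha j (Finset.mem_insert_of_mem hj)
      rwa [pow_succ, mul_assoc] at this
    have h2 : v.size (a i) < v.size t * γ := by
      refine (ha i (Finset.mem_insert_self _ _)).trans_le ?_
      gcongr
      rw [pow_succ]
      exact mul_le_of_le_one_left' (pow_le_one' (h.size_le_one ht) _)
    exact lt_of_mul_lt_mul_left' ((h.size_add_le ht _ _).trans_lt (max_lt h2 h1))

/-- The homogenization of `f`, evaluated at `(x, y)`; for `y = 0` the value is taken to be `x`. -/
noncomputable def homogEval (f : K[X]) (x y : K) : K :=
  open Classical in if y = 0 then x else y ^ f.natDegree * f.eval (x / y)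

theorem CondLeadingTerm.exists_eval {f : K[X]} {t : K} {v : Locality K} (ht : t ≠ 0)
    (h : CondLeadingTerm f t v) {x : K} (hx : 1 < v.size x) :
    ∃ u : K, f.eval x = x ^ f.natDegree * u ∧ v.size t ≤ v.size u ∧ v.size u ≤ 1 := by
  have hx' : x ∉ v.ball := fun h' => not_le.2 hx (mem_ball_iff.1 h')
  obtain ⟨⟨u, ⟨hu, hu'⟩, hux⟩, -⟩ := h x hx'
  refine ⟨u, hux.symm, ?_, mem_ball_iff.1 hu⟩
  exact not_lt.1 fun h' => hu' ((mem_smul_maximal_iff ht).2 h')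

/-- The value is M^d times an element of size at most 1, where M is the larger of |x|, |y|; and M^d
≤ M since M ≤ 1. -/
theorem size_homogEval_le {f : K[X]} {t : K} {v : Locality K} (ht : t ≠ 0)
    (hd : 2 ≤ f.natDegree) (h1 : CondIntegral f v) (h2 : CondLeadingTerm f t v) {x y : K}
    (hx : v.size x ≤ 1) (hy : v.size y ≤ 1) :
    v.size (homogEval f x y) ≤ max (v.size x) (v.size y) := by
  unfold homogEval
  split_ifs with hy0
  · exact le_max_left _ _
  have hpos := (size_pos (v := v)).2 hy0
  have hd0 : f.natDegree ≠ 0 := by omega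
  rcases le_or_gt (v.size x) (v.size y) with hxy | hxy
  · refine le_trans ?_ (le_max_right _ _)
    have : v.size (f.eval (x / y)) ≤ 1 := by
      refine mem_ball_iff.1 (h1 _ (mem_ball_iff.2 ?_))
      rw [map_div₀]
      exact div_le_one_of_le₀ hxy hpos.le
    rw [map_mul, map_pow]
    exact (mul_le_of_le_one_right' this).trans (pow_le_of_le_one zero_le hy hd0)
  · refine le_trans ?_ (le_max_left _ _)
    have hgt : 1 < v.size (x / y) := by rwa [map_div₀, one_lt_div₀ hpos]
    obtain ⟨u, hu, -, hu1⟩ := h2.exists_eval ht hgt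
    have : y ^ f.natDegree * f.eval (x / y) = x ^ f.natDegree * u := by
      rw [hu, div_pow]; field_simp
    rw [this, map_mul, map_pow]
    exact (mul_le_of_le_one_right' hu1).trans (pow_le_of_le_one zero_le hx hd0)

theorem le_size_pow_mul {v : Locality K} {t x u : K} {d : ℕ} (hd : 2 ≤ d)
    (ht : v.size t ≤ 1) (hu : v.size t ≤ v.size u) (hx : 1 < v.size t * v.size x) :
    v.size x ≤ v.size (x ^ d * u) := by
  have hx1 : 1 ≤ v.size x := hx.le.trans (mul_le_of_le_one_left' ht)
  rw [map_mul, map_pow]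
  calc v.size x ≤ v.size t * v.size x * v.size x := le_mul_of_one_le_left' hx.le
    _ = v.size x ^ 2 * v.size t := by rw [mul_assoc, ← sq, mul_comm]
    _ ≤ v.size x ^ d * v.size u := by gcongr

/-- With M the larger size, the value has size at least M^d |t|, which is at least M · (M|t|)
because d ≥ 2. If |x| ≤ |y|, the factor |t| comes from the absence of approximate zeros, otherwise
from the leading term. -/
theorem le_size_homogEval {f : K[X]} {t : K} {v : Locality K} (ht : t ≠ 0)
    (hd : 2 ≤ f.natDegree) (h2 : CondLeadingTerm f t v) (ht1 : v.size t ≤ 1) {x y : K}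
    (hxy : CondNoApproxZero f t v ∨ v.size y < v.size x)
    (hmax : 1 < v.size t * max (v.size x) (v.size y)) :
    max (v.size x) (v.size y) ≤ v.size (homogEval f x y) := by
  unfold homogEval
  -- The default value `x` at `y = 0` has size exactly the maximum, so the leading coefficient need
  -- not be estimated.
  split_ifs with hy0
  · simp [hy0]
  have hpos := (size_pos (v := v)).2 hy0
  rcases le_or_gt (v.size x) (v.size y) with hle | hlt
  · have h3 := hxy.resolve_right hle.not_gt
    rw [max_eq_right hle] at hmax ⊢
    refine le_size_pow_mul hd ht1 ?_ hmax
    refine not_lt.1 fun h' => h3 (x / y) (mem_ball_iff.2 ?_) ((mem_smul_maximal_iff ht).2 h')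
    rw [map_div₀]
    exact div_le_one_of_le₀ hle hpos.le
  · rw [max_eq_left hlt.le] at hmax ⊢
    have hgt : 1 < v.size (x / y) := by rwa [map_div₀, one_lt_div₀ hpos]
    obtain ⟨u, hu, htu, -⟩ := h2.exists_eval ht hgt
    have : y ^ f.natDegree * f.eval (x / y) = x ^ f.natDegree * u := by
      rw [hu, div_pow]; field_simp
    rw [this]
    exact le_size_pow_mul hd ht1 htu hmax

end Locality

/-! ### Weak approximation of sizes at finitely many localities -/

namespace Locality

variable {K : Type u} [Field K]

/-- `x` is larger at `v` than all elements of `C`. -/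
def Large (C : Finset K) (v : Locality K) (x : K) : Prop := ∀ c ∈ C, v.size c < v.size x

/-- `x` is smaller at `v` than the inverses of all elements of `C`. -/
def Small (C : Finset K) (v : Locality K) (x : K) : Prop := ∀ c ∈ C, v.size c * v.size x < 1

theorem Large.mono {C C' : Finset K} {v : Locality K} {x : K} (h : Large C v x) (hC : C' ⊆ C) :
    Large C' v x := fun c hc => h c (hC hc)

theorem Small.mono {C C' : Finset K} {v : Locality K} {x : K} (h : Small C v x) (hC : C' ⊆ C) :
    Small C' v x := fun c hc => h c (hC hc)

theorem Large.inv {C : Finset K} {v : Locality K} {x : K} (h : Large C v x) (hx : x ≠ 0) :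
    Small C v x⁻¹ := fun c hc => by
  rw [map_inv₀, ← div_eq_mul_inv, div_lt_one₀ (size_pos.2 hx)]
  exact h c hc

theorem Small.inv {C : Finset K} {v : Locality K} {x : K} (h : Small C v x) (hx : x ≠ 0) :
    Large C v x⁻¹ := fun c hc => by
  rw [map_inv₀, ← one_div, lt_div_iff₀ (size_pos.2 hx)]
  exact h c hc

theorem exists_one_lt_size {v : Locality K} (hv : v ≠ trivial K) : ∃ g : K, 1 < v.size g := by
  by_contra! h
  refine hv (Subtype.ext (UnitBall.ext (eq_univ_of_forall fun x => ?_)))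
  · exact mem_ball_iff.2 (h x)

theorem exists_size_le (v : Locality K) (C : Finset K) :
    ∃ c : K, c ≠ 0 ∧ ∀ c' ∈ C, v.size c' ≤ v.size c := by
  classical
  obtain ⟨c, -, hc⟩ := (insert 1 C).exists_max_image v.size (Finset.insert_nonempty _ _)
  refine ⟨c, (size_pos (v := v)).1 ?_, fun c' hc' => hc c' (Finset.mem_insert_of_mem hc')⟩
  refine lt_of_lt_of_le ?_ (hc 1 (Finset.mem_insert_self _ _))
  rw [map_one]
  exact zero_lt_one

theorem exists_large {v : Locality K} (hv : v ≠ trivial K) (C : Finset K) :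
    ∃ x : K, x ≠ 0 ∧ Large C v x := by
  obtain ⟨g, hg⟩ := exists_one_lt_size hv
  obtain ⟨c, hc0, hc⟩ := v.exists_size_le C
  have hg0 : g ≠ 0 := size_pos.1 (zero_lt_one.trans hg)
  refine ⟨c * g, mul_ne_zero hc0 hg0, fun c' hc' => (hc c' hc').trans_lt ?_⟩
  rw [map_mul]
  exact lt_mul_of_one_lt_right (size_pos.2 hc0) hg

/-- The filter whose translates generate the `v`-topology. -/
abbrev zeroFilter (v : Locality K) : Filter K := ⨅ z ∈ {z : K | z ≠ 0}, 𝓟 (z • v.maximal)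

theorem exists_small_large_of_notMem {v w : Locality K} (hw : w ≠ trivial K) {z : K}
    (hz : z ≠ 0) (h : z • w.maximal ∉ v.zeroFilter) (C : Finset K) :
    ∃ x : K, x ≠ 0 ∧ Small C v x ∧ Large C w x := by
  have key : ∀ q : K, q ≠ 0 → ∃ x, v.size x < v.size q ∧ w.size z ≤ w.size x := by
    intro q hq
    by_contra! hcon
    refine h (Filter.mem_of_superset (mem_iInf_of_mem q (mem_iInf_of_mem hq
      (mem_principal_self _))) fun x hx => ?_)
    exact (mem_smul_maximal_iff hz).2 (hcon x ((mem_smul_maximal_iff hq).1 hx))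
  obtain ⟨b, hb0, hb⟩ := v.exists_size_le C
  obtain ⟨c, hc0, hc⟩ := exists_large hw C
  -- `b` bounds `C` at `v` and `c` exceeds `C` at `w`. Multiplying by `c/z` lifts |x| ≥ |z| at `w`
  -- to the size of `c`; the radius at `v` is chosen to compensate for both `b` and `c/z`.
  obtain ⟨x, hxv, hxw⟩ := key (b⁻¹ * z * c⁻¹)
    (mul_ne_zero (mul_ne_zero (inv_ne_zero hb0) hz) (inv_ne_zero hc0))
  have hx0 : x ≠ 0 := size_pos.1 ((size_pos.2 hz).trans_le hxw)
  refine ⟨x * (c * z⁻¹), mul_ne_zero hx0 (mul_ne_zero hc0 (inv_ne_zero hz)), ?_, ?_⟩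
  · intro c' hc'
    have hpos : 0 < v.size (c * z⁻¹) := size_pos.2 (mul_ne_zero hc0 (inv_ne_zero hz))
    calc v.size c' * v.size (x * (c * z⁻¹))
        ≤ v.size b * (v.size x * v.size (c * z⁻¹)) := by
          rw [map_mul]; exact mul_le_mul_left (hb c' hc') _
      _ < v.size b * (v.size (b⁻¹ * z * c⁻¹) * v.size (c * z⁻¹)) :=
          mul_lt_mul_of_pos_left (mul_lt_mul_of_pos_right hxv hpos) (size_pos.2 hb0)
      _ = 1 := by
          rw [← map_mul v.size, ← map_mul v.size, ← map_one v.size]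
          exact congrArg _ (by field_simp)
  · intro c' hc'
    refine (hc c' hc').trans_le ?_
    have : w.size c = w.size z * w.size (c * z⁻¹) := by
      rw [← map_mul]; congr 1; field_simp
    rw [this, map_mul w.size x]
    gcongr

/-- Distinct topologies have distinct generating filters, so some ball of one locality is not a
neighbourhood of 0 for the other. Inversion exchanges small and large, so it does not matter which
one. -/
theorem Independent.exists_small_large {v w : Locality K} (h : Independent v w)
    (hv : v ≠ trivial K) (hw : w ≠ trivial K) (C : Finset K) :
    ∃ x : K, x ≠ 0 ∧ Small C v x ∧ Large C w x := by
  by_cases h1 : ∃ z : K, z ≠ 0 ∧ z • w.maximal ∉ v.zeroFilter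
  · obtain ⟨z, hz, h1⟩ := h1
    exact exists_small_large_of_notMem hw hz h1 C
  by_cases h2 : ∃ z : K, z ≠ 0 ∧ z • v.maximal ∉ w.zeroFilter
  · obtain ⟨z, hz, h2⟩ := h2
    obtain ⟨x, hx, hx1, hx2⟩ := exists_small_large_of_notMem hv hz h2 C
    exact ⟨x⁻¹, inv_ne_zero hx, hx2.inv hx, hx1.inv hx⟩
  push Not at h1 h2
  refine absurd ?_ h
  have heq : v.zeroFilter = w.zeroFilter :=
    le_antisymm (le_iInf₂ fun z hz => le_principal_iff.2 (h1 z hz))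
      (le_iInf₂ fun z hz => le_principal_iff.2 (h2 z hz))
  change translationTopology v.zeroFilter = translationTopology w.zeroFilter
  rw [heq]

/-- Induction on `T`. If the element `x` found for the old localities fails to be large at the new
`w`, add an `x'` that is large there: `x'` dominates the sum at `w`, and `x` dominates it on the old
set. -/
theorem exists_small_large_insert {t : K} (ht : t ≠ 0) {A : Set (Locality K)}
    (hA : ∀ v ∈ A, CondPlus t v) (T : Finset (Locality K)) (hT : ∀ w ∈ T, CondPlus t w)
    (h0 : ∀ C : Finset K, ∃ x : K, x ≠ 0 ∧ ∀ v ∈ A, Small C v x)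
    (h1 : ∀ w ∈ T, ∀ C : Finset K, ∃ x : K, (∀ v ∈ A, Small C v x) ∧ Large C w x)
    (C : Finset K) :
    ∃ x : K, x ≠ 0 ∧ (∀ v ∈ A, Small C v x) ∧ ∀ w ∈ T, Large C w x := by
  classical
  induction T using Finset.induction_on generalizing C with
  | empty =>
    obtain ⟨x, hx0, hx⟩ := h0 C
    exact ⟨x, hx0, hx, by simp⟩
  | insert w T hwT ih =>
    have hw := hT w (Finset.mem_insert_self _ _)
    have htw := hw.size_le_one ht
    obtain ⟨x', hx'A, hx'w⟩ := h1 w (Finset.mem_insert_self _ _)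
      (C.image (fun c => t⁻¹ * c) ∪ C.image (fun c => t⁻¹ * (t⁻¹ * c)))
    -- `x` is chosen after `x'`, so that `t⁻¹ * x'` can be a threshold for it on the old `T`.
    obtain ⟨x, hx0, hxA, hxT⟩ := ih (fun w hw => hT w (Finset.mem_insert_of_mem hw))
      (fun w hw => h1 w (Finset.mem_insert_of_mem hw))
      (C ∪ (C.image (fun c => t⁻¹ * c) ∪ {t⁻¹ * x'}))
    by_cases hxw : Large C w x
    · refine ⟨x, hx0, fun v hv => (hxA v hv).mono Finset.subset_union_left, fun w' hw' => ?_⟩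
      rcases Finset.mem_insert.1 hw' with rfl | hw'
      · exact hxw
      · exact (hxT w' hw').mono Finset.subset_union_left
    have hinv : ∀ (v : Locality K) (c : K), v.size (t⁻¹ * c) = (v.size t)⁻¹ * v.size c :=
      fun v c => by rw [map_mul, map_inv₀]
    obtain ⟨c0, hc0, hxc⟩ : ∃ c ∈ C, w.size x ≤ w.size c := by
      simpa [Large] using hxw
    have htpos : ∀ v : Locality K, 0 < v.size t := fun v => size_pos.2 ht
    have hx'c : ∀ c ∈ C, w.size c < w.size t * (w.size t * w.size x') := by
      intro c hc
      have := hx'w (t⁻¹ * (t⁻¹ * c)) (Finset.mem_union_right _ (Finset.mem_image_of_mem _ hc))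
      rwa [hinv, hinv, inv_mul_lt_iff₀ (htpos w), inv_mul_lt_iff₀ (htpos w)] at this
    have hle : w.size t * (w.size t * w.size x') ≤ w.size t * w.size x' :=
      mul_le_of_le_one_left' htw
    have hsum : ∀ c ∈ C, w.size c < w.size (x + x') := by
      intro c hc
      rw [add_comm]
      refine ((hx'c c hc).trans_le hle).trans_le (hw.le_size_add ht ?_)
      exact (hxc.trans_lt (hx'c c0 hc0)).trans_le hle
    refine ⟨x + x', ?_, ?_, ?_⟩
    · exact size_pos.1 ((zero_le).trans_lt (hsum c0 hc0))
    · intro v hv c hc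
      have h3 := hxA v hv (t⁻¹ * c) (by
        simp only [Finset.mem_union]
        exact Or.inr (Or.inl (Finset.mem_image_of_mem _ hc)))
      have h4 := hx'A v hv (t⁻¹ * c) (Finset.mem_union_left _ (Finset.mem_image_of_mem _ hc))
      have h5 := (hA v hv).size_add_le ht x x'
      rw [hinv] at h3 h4
      calc v.size c * v.size (x + x')
          = (v.size t)⁻¹ * v.size c * (v.size t * v.size (x + x')) := by
            rw [mul_mul_mul_comm, inv_mul_cancel₀ (htpos v).ne', one_mul]
        _ ≤ (v.size t)⁻¹ * v.size c * max (v.size x) (v.size x') := by gcongr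
        _ < 1 := by
          rcases max_choice (v.size x) (v.size x') with h | h <;> rw [h] <;> assumption
    · intro w' hw'
      rcases Finset.mem_insert.1 hw' with rfl | hw'
      · exact hsum
      intro c hc
      have h3 := hxT w' hw' (t⁻¹ * c) (by
        simp only [Finset.mem_union]
        exact Or.inr (Or.inl (Finset.mem_image_of_mem _ hc)))
      have h4 := hxT w' hw' (t⁻¹ * x') (by simp)
      rw [hinv, inv_mul_lt_iff₀ (htpos w')] at h3 h4
      exact h3.trans_le ((hT w' (Finset.mem_insert_of_mem hw')).le_size_add ht h4)

/-- Weak approximation (of sizes) for finitely many pairwise independent localities. -/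
theorem exists_small_large_of_finite {t : K} (ht : t ≠ 0) {A T : Finset (Locality K)}
    (hA : ∀ v ∈ A, CondPlus t v ∧ v ≠ trivial K) (hT : ∀ v ∈ T, CondPlus t v ∧ v ≠ trivial K)
    (hI : ∀ v ∈ A, ∀ w ∈ T, Independent v w) (C : Finset K) :
    ∃ x : K, x ≠ 0 ∧ (∀ v ∈ A, Small C v x) ∧ ∀ w ∈ T, Large C w x := by
  have hlarge : ∀ T : Finset (Locality K), (∀ v ∈ T, CondPlus t v ∧ v ≠ trivial K) →
      ∀ C : Finset K, ∃ x : K, x ≠ 0 ∧ ∀ v ∈ T, Large C v x := by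
    intro T hT C
    obtain ⟨x, hx, -, h⟩ := exists_small_large_insert ht (A := ∅) (by simp) T
      (fun w hw => (hT w hw).1) (fun C => ⟨1, one_ne_zero, by simp⟩)
      (fun w hw C => by
        obtain ⟨x, -, hx⟩ := exists_large (hT w hw).2 C
        exact ⟨x, by simp, hx⟩) C
    exact ⟨x, hx, h⟩
  have hsmall : ∀ T : Finset (Locality K), (∀ v ∈ T, CondPlus t v ∧ v ≠ trivial K) →
      ∀ C : Finset K, ∃ x : K, x ≠ 0 ∧ ∀ v ∈ T, Small C v x := by
    intro T hT C
    obtain ⟨x, hx, h⟩ := hlarge T hT C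
    exact ⟨x⁻¹, inv_ne_zero hx, fun v hv => (h v hv).inv hx⟩
  -- Elements small at one `v` and large on `T` become, after inversion, the input for a second
  -- round with the roles of `A` and `T` exchanged.
  have hone : ∀ v ∈ A, ∀ C : Finset K,
      ∃ x : K, (∀ w ∈ (T : Set (Locality K)), Small C w x) ∧ Large C v x := by
    intro v hv C
    obtain ⟨x, hx, h1, h2⟩ := exists_small_large_insert ht (A := {v})
      (by simpa using (hA v hv).1) T (fun w hw => (hT w hw).1)
      (fun C => by simpa using hsmall {v} (by simpa using hA v hv) C)
      (fun w hw C => by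
        obtain ⟨x, -, h⟩ := (hI v hv w hw).exists_small_large (hA v hv).2 (hT w hw).2 C
        exact ⟨x, by simpa using h.1, h.2⟩) C
    exact ⟨x⁻¹, fun w hw => (h2 w hw).inv hx, (h1 v rfl).inv hx⟩
  obtain ⟨x, hx, h1, h2⟩ := exists_small_large_insert ht (A := T) (fun w hw => (hT w hw).1) A
    (fun v hv => (hA v hv).1) (hsmall T hT) hone C
  exact ⟨x⁻¹, inv_ne_zero hx, fun v hv => (h2 v hv).inv hx, fun w hw => (h1 w hw).inv hx⟩

end Locality

/-! ### Compactness: elements large on one set of localities and small on another -/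

namespace Locality

variable {K : Type u} [Field K]

/-- The conditions on a single locality that do not concern zeros of `f` in `O_v`. -/
structure Admissible (f : K[X]) (t : K) (v : Locality K) : Prop where
  integral : CondIntegral f v
  leading : CondLeadingTerm f t v
  plus : CondPlus t v
  ne_trivial : v ≠ trivial K

/-- The union of a constructibly compact set of localities in whose unit balls `f` has no
approximate zeros, and a finite set. -/
def AlmostUniform (f : K[X]) (t : K) (T : Set (Locality K)) : Prop :=
  ∃ T₁ T₂ : Set (Locality K), T = T₁ ∪ T₂ ∧ @IsCompact _ (constructibleTopology K) T₁ ∧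
    (∀ v ∈ T₁, CondNoApproxZero f t v) ∧ T₂.Finite

theorem AlmostUniform.empty (f : K[X]) (t : K) : AlmostUniform f t ∅ :=
  ⟨∅, ∅, by simp, @isCompact_empty _ (constructibleTopology K), by simp, finite_empty⟩

theorem AlmostUniform.union {f : K[X]} {t : K} {T T' : Set (Locality K)}
    (h : AlmostUniform f t T) (h' : AlmostUniform f t T') : AlmostUniform f t (T ∪ T') := by
  obtain ⟨T₁, T₂, rfl, h1, h2, h3⟩ := h
  obtain ⟨T₁', T₂', rfl, h1', h2', h3'⟩ := h'
  refine ⟨T₁ ∪ T₁', T₂ ∪ T₂', union_union_union_comm _ _ _ _, ?_, ?_, h3.union h3'⟩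
  · exact @IsCompact.union _ (constructibleTopology K) _ _ h1 h1'
  · rintro v (hv | hv)
    exacts [h2 v hv, h2' v hv]

theorem AlmostUniform.biUnion {f : K[X]} {t : K} {ι : Type*} (s : Finset ι)
    (T : ι → Set (Locality K)) (h : ∀ i ∈ s, AlmostUniform f t (T i)) :
    AlmostUniform f t (⋃ i ∈ s, T i) := by
  classical
  induction s using Finset.induction_on with
  | empty => simpa using AlmostUniform.empty f t
  | insert i s hi ih =>
    rw [Finset.set_biUnion_insert]
    exact (h i (Finset.mem_insert_self _ _)).union
      (ih fun j hj => h j (Finset.mem_insert_of_mem hj))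

theorem isOpen_setOf_mem_maximal (x : K) :
    IsOpen[constructibleTopology K] {v : Locality K | x ∈ v.maximal} :=
  ⟨{O : UnitBall K | x ∈ O.maximal},
    TopologicalSpace.isOpen_generateFrom_of_mem (Or.inr ⟨x, rfl⟩), rfl⟩

theorem isOpen_setOf_mem_ball (x : K) :
    IsOpen[constructibleTopology K] {v : Locality K | x ∈ v.ball} :=
  ⟨{O : UnitBall K | x ∈ O.carrier},
    TopologicalSpace.isOpen_generateFrom_of_mem (Or.inl ⟨x, rfl⟩), rfl⟩

/-- For `x ≠ 0` the complement is the subbasic open set given by `x⁻¹ ∈ O_v`. -/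
theorem isClosed_setOf_mem_maximal (x : K) :
    IsClosed[constructibleTopology K] {v : Locality K | x ∈ v.maximal} := by
  let _ := constructibleTopology K
  refine ⟨?_⟩
  by_cases hx : x = 0
  · convert isOpen_empty
    refine eq_empty_of_forall_notMem fun v hv => hv ?_
    exact mem_maximal_iff.2 (by simp [hx])
  · convert isOpen_setOf_mem_ball x⁻¹ using 1
    ext v
    simp only [mem_compl_iff, mem_ofPred_eq, mem_maximal_iff, mem_ball_iff, not_lt, map_inv₀]
    exact (inv_le_one₀ (size_pos.2 hx)).symm

theorem isOpen_setOf_large (C : Finset K) (x : K) :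
    IsOpen[constructibleTopology K] {v : Locality K | Large C v x} := by
  let _ := constructibleTopology K
  have : {v : Locality K | Large C v x} = ⋂ c ∈ C, {v : Locality K | v.size c < v.size x} := by
    ext v; simp [Large]
  rw [this]
  refine isOpen_biInter_finset fun c _ => ?_
  by_cases hx : x = 0
  · convert isOpen_empty
    exact eq_empty_of_forall_notMem fun v hv => by simp [hx] at hv
  · convert isOpen_setOf_mem_maximal (c / x) using 1
    ext v
    simp only [mem_ofPred_eq, mem_maximal_iff, map_div₀]
    exact (div_lt_one₀ (size_pos.2 hx)).symm

/-- The threshold `t⁻¹` provides the hypothesis 1 < |t| max(|x|,|y|) of `le_size_homogEval`. -/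
theorem Large.homogEval {f : K[X]} {t : K} {v : Locality K} (ht : t ≠ 0)
    (hd : 2 ≤ f.natDegree) (hv : Admissible f t v) {C : Finset K} (htC : t⁻¹ ∈ C) {x y : K}
    (hxy : CondNoApproxZero f t v ∨ v.size y < v.size x) (h : Large C v x ∨ Large C v y) :
    Large C v (homogEval f x y) := by
  have hmax : ∀ c ∈ C, v.size c < max (v.size x) (v.size y) := by
    intro c hc
    rcases h with h | h
    exacts [(h c hc).trans_le (le_max_left _ _), (h c hc).trans_le (le_max_right _ _)]
  intro c hc
  refine (hmax c hc).trans_le (le_size_homogEval ht hd hv.leading (hv.plus.size_le_one ht) hxy ?_)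
  have := hmax _ htC
  rwa [map_inv₀, inv_lt_iff_one_lt_mul₀' (size_pos.2 ht)] at this

theorem Small.homogEval {f : K[X]} {t : K} {v : Locality K} (ht : t ≠ 0)
    (hd : 2 ≤ f.natDegree) (hv : Admissible f t v) {C : Finset K} (hC : 1 ∈ C) {x y : K}
    (hx : Small C v x) (hy : Small C v y) : Small C v (homogEval f x y) := by
  intro c hc
  have h1 : ∀ {x}, Small C v x → v.size x ≤ 1 := fun hx => by simpa using (hx 1 hC).le
  refine (mul_le_mul_right (size_homogEval_le ht hd hv.integral hv.leading (h1 hx) (h1 hy))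
    (v.size c)).trans_lt ?_
  rcases max_choice (v.size x) (v.size y) with h | h <;> rw [h]
  exacts [hx c hc, hy c hc]

/-- Elements that are large at single localities can be combined to one that is large at all
localities of an almost uniform set, inside any set closed under the homogenization of `f`. -/
theorem exists_large_of_forall {f : K[X]} {t : K} (ht : t ≠ 0) (hd : 2 ≤ f.natDegree)
    {X : Set K} (hX : ∀ x ∈ X, ∀ y ∈ X, homogEval f x y ∈ X) {T₁ T₂ : Set (Locality K)}
    (hT₁ : @IsCompact _ (constructibleTopology K) T₁) (hT₁' : ∀ v ∈ T₁, CondNoApproxZero f t v)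
    (hadm₁ : ∀ v ∈ T₁, Admissible f t v) (hadm₂ : ∀ v ∈ T₂, Admissible f t v)
    (h₁ : ∀ v ∈ T₁, ∀ C : Finset K, ∃ x ∈ X, Large C v x)
    (h₂ : ∀ C : Finset K, ∃ x ∈ X, ∀ v ∈ T₂, Large C v x) (C : Finset K) :
    ∃ x ∈ X, ∀ v ∈ T₁ ∪ T₂, Large C v x := by
  classical
  let _ := constructibleTopology K
  -- Compactness of `T₁` in the form of an induction over subsets: local solutions exist by openness
  -- of largeness, and two solutions merge under `homogEval`.
  have key : ∃ y ∈ X, ∀ v ∈ T₁ ∩ T₁, Large (insert t⁻¹ C) v y := by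
    refine hT₁.induction_on (p := fun s => ∃ y ∈ X, ∀ v ∈ s ∩ T₁, Large (insert t⁻¹ C) v y)
      ?_ ?_ ?_ ?_
    · obtain ⟨x, hx, -⟩ := h₂ ∅
      exact ⟨x, hx, by simp⟩
    · rintro s s' hs ⟨y, hy, h⟩
      exact ⟨y, hy, fun v hv => h v ⟨hs hv.1, hv.2⟩⟩
    · rintro s s' ⟨y, hy, h⟩ ⟨y', hy', h'⟩
      refine ⟨homogEval f y y', hX _ hy _ hy', fun v hv => ?_⟩
      refine Large.homogEval ht hd (hadm₁ v hv.2) (Finset.mem_insert_self _ _)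
        (Or.inl (hT₁' v hv.2)) ?_
      exact hv.1.imp (fun h1 => h v ⟨h1, hv.2⟩) (fun h1 => h' v ⟨h1, hv.2⟩)
    · intro v hv
      obtain ⟨x, hx, hxv⟩ := h₁ v hv (insert t⁻¹ C)
      exact ⟨{w | Large (insert t⁻¹ C) w x},
        mem_nhdsWithin_of_mem_nhds ((isOpen_setOf_large _ x).mem_nhds hxv), x, hx,
        fun w hw => hw.1⟩
  obtain ⟨y, hy, hyT⟩ := key
  -- Making `x` larger than `y` on `T₂` gives |y| < |x| there, which replaces the missing condition
  -- on approximate zeros.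
  obtain ⟨x, hx, hxT⟩ := h₂ (insert y (insert t⁻¹ C))
  refine ⟨homogEval f x y, hX _ hx _ hy, ?_⟩
  rintro v (hv | hv)
  · exact (Large.homogEval ht hd (hadm₁ v hv) (Finset.mem_insert_self _ _)
      (Or.inl (hT₁' v hv)) (Or.inr (hyT v ⟨hv, hv⟩))).mono (Finset.subset_insert _ _)
  · exact (Large.homogEval ht hd (hadm₂ v hv) (Finset.mem_insert_self _ _)
      (Or.inr (hxT v hv y (Finset.mem_insert_self _ _)))
      (Or.inl ((hxT v hv).mono (Finset.subset_insert _ _)))).mono (Finset.subset_insert _ _)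

/-- The elements small on `A` are closed under `homogEval`, and finite weak approximation provides
members of this set that are large at prescribed points of `B`. -/
theorem exists_finset_small_large {f : K[X]} {t : K} (ht : t ≠ 0) (hd : 2 ≤ f.natDegree)
    {A : Finset (Locality K)} {B : Set (Locality K)} (hA : ∀ v ∈ A, Admissible f t v)
    (hB : ∀ v ∈ B, Admissible f t v) (hBu : AlmostUniform f t B)
    (hI : ∀ v ∈ A, ∀ w ∈ B, Independent v w) (C : Finset K) :
    ∃ x : K, x ≠ 0 ∧ (∀ v ∈ A, Small C v x) ∧ ∀ w ∈ B, Large C w x := by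
  classical
  obtain ⟨B₁, B₂, rfl, hc, hn, hfin⟩ := hBu
  have hfinite : ∀ T : Finset (Locality K), ↑T ⊆ B₁ ∪ B₂ → ∀ C : Finset K,
      ∃ x : K, x ≠ 0 ∧ (∀ v ∈ A, Small C v x) ∧ ∀ w ∈ T, Large C w x := fun T hT C =>
    exists_small_large_of_finite ht (fun v hv => ⟨(hA v hv).plus, (hA v hv).ne_trivial⟩)
      (fun v hv => ⟨(hB v (hT hv)).plus, (hB v (hT hv)).ne_trivial⟩)
      (fun v hv w hw => hI v hv w (hT hw)) C
  have hX : ∀ {C' : Finset K} {x : K}, (∀ v ∈ A, Small (C' ∪ insert 1 C) v x) →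
      x ∈ {x : K | ∀ v ∈ A, Small (insert 1 C) v x} := fun h v hv =>
    (h v hv).mono Finset.subset_union_right
  obtain ⟨x, hx, hxB⟩ := exists_large_of_forall ht hd
    (X := {x : K | ∀ v ∈ A, Small (insert 1 C) v x})
    (fun x hx y hy v hv => (hx v hv).homogEval ht hd (hA v hv) (Finset.mem_insert_self _ _)
      (hy v hv)) hc hn (fun v hv => hB v (Or.inl hv)) (fun v hv => hB v (Or.inr hv))
    (fun v hv C' => by
      obtain ⟨x, -, h1, h2⟩ := hfinite {v} (by simpa using Or.inl hv) (C' ∪ insert 1 C)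
      exact ⟨x, hX h1, (h2 v (Finset.mem_singleton_self v)).mono Finset.subset_union_left⟩)
    (fun C' => by
      obtain ⟨x, -, h1, h2⟩ := hfinite hfin.toFinset (by simp) (C' ∪ insert 1 C)
      exact ⟨x, hX h1, fun v hv =>
        (h2 v (hfin.mem_toFinset.2 hv)).mono Finset.subset_union_left⟩) (insert 0 C)
  -- The additional threshold 0 forces `x ≠ 0` as soon as `B` has a point.
  rcases (B₁ ∪ B₂).eq_empty_or_nonempty with he | ⟨w, hw⟩
  · obtain ⟨x, hx, h1, -⟩ := hfinite ∅ (by simp) C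
    exact ⟨x, hx, h1, by simp [he]⟩
  · refine ⟨x, ?_, fun v hv => (hx v hv).mono (Finset.subset_insert _ _),
      fun v hv => (hxB v hv).mono (Finset.subset_insert _ _)⟩
    have := hxB w hw 0 (Finset.mem_insert_self _ _)
    rwa [map_zero, size_pos] at this

/-- The same argument once more, on the set of elements small on `B`; its inputs are inverses of the
elements from `exists_finset_small_large`. -/
theorem exists_large_small {f : K[X]} {t : K} (ht : t ≠ 0) (hd : 2 ≤ f.natDegree)
    {A B : Set (Locality K)} (hA : ∀ v ∈ A, Admissible f t v)
    (hB : ∀ v ∈ B, Admissible f t v) (hAu : AlmostUniform f t A) (hBu : AlmostUniform f t B)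
    (hI : ∀ v ∈ A, ∀ w ∈ B, Independent v w) (hne : A.Nonempty) (C : Finset K) :
    ∃ x : K, x ≠ 0 ∧ (∀ v ∈ A, Large C v x) ∧ ∀ w ∈ B, Small C w x := by
  classical
  obtain ⟨A₁, A₂, rfl, hc, hn, hfin⟩ := hAu
  have hfinite : ∀ T : Finset (Locality K), ↑T ⊆ A₁ ∪ A₂ → ∀ C' : Finset K,
      ∃ x ∈ {x : K | ∀ v ∈ B, Small (insert 1 C) v x}, ∀ w ∈ T, Large C' w x := by
    intro T hT C'
    obtain ⟨x, hx, h1, h2⟩ := exists_finset_small_large ht hd (fun v hv => hA v (hT hv)) hB hBu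
      (fun v hv => hI v (hT hv)) (C' ∪ insert 1 C)
    exact ⟨x⁻¹, fun v hv => ((h2 v hv).mono Finset.subset_union_right).inv hx,
      fun v hv => ((h1 v hv).mono Finset.subset_union_left).inv hx⟩
  obtain ⟨x, hx, hxA⟩ := exists_large_of_forall ht hd
    (X := {x : K | ∀ v ∈ B, Small (insert 1 C) v x})
    (fun x hx y hy v hv => (hx v hv).homogEval ht hd (hB v hv) (Finset.mem_insert_self _ _)
      (hy v hv)) hc hn (fun v hv => hA v (Or.inl hv)) (fun v hv => hA v (Or.inr hv))
    (fun v hv C' => by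
      obtain ⟨x, h1, h2⟩ := hfinite {v} (by simpa using Or.inl hv) C'
      exact ⟨x, h1, h2 v (Finset.mem_singleton_self v)⟩)
    (fun C' => by
      obtain ⟨x, h1, h2⟩ := hfinite hfin.toFinset (by simp) C'
      exact ⟨x, h1, fun v hv => h2 v (hfin.mem_toFinset.2 hv)⟩) (insert 0 C)
  obtain ⟨w, hw⟩ := hne
  refine ⟨x, ?_, fun v hv => (hxA v hv).mono (Finset.subset_insert _ _),
    fun v hv => (hx v hv).mono (Finset.subset_insert _ _)⟩
  have := hxA w hw 0 (Finset.mem_insert_self _ _)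
  rwa [map_zero, size_pos] at this

end Locality

/-! ### Approximation of elements, and thresholds for the topologies -/

namespace Locality

variable {K : Type u} [Field K]

/-- Take `e = x/(1+x)` with `x` large on `A` and small on `B`, so that `e - 1 = -1/(1+x)`; the
denominator is bounded below by `CondPlus.le_size_add`. -/
theorem exists_near_one_near_zero {f : K[X]} {t : K} (ht : t ≠ 0) (hd : 2 ≤ f.natDegree)
    {A B : Set (Locality K)} (hA : ∀ v ∈ A, Admissible f t v)
    (hB : ∀ v ∈ B, Admissible f t v) (hAu : AlmostUniform f t A) (hBu : AlmostUniform f t B)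
    (hI : ∀ v ∈ A, ∀ w ∈ B, Independent v w) (hne : A.Nonempty) (C : Finset K) :
    ∃ e : K, (∀ v ∈ A, Small C v (e - 1)) ∧ ∀ w ∈ B, Small C w e := by
  classical
  obtain ⟨x, hx0, hxA, hxB⟩ := exists_large_small ht hd hA hB hAu hBu hI hne
    (insert t⁻¹ (C.image fun c => t⁻¹ * c))
  have htpos : ∀ v : Locality K, 0 < v.size t := fun v => size_pos.2 ht
  have hA' : ∀ v ∈ A, v.size t * v.size x ≤ v.size (1 + x) := by
    intro v hv
    rw [add_comm]
    refine (hA v hv).plus.le_size_add ht ?_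
    have := hxA v hv t⁻¹ (Finset.mem_insert_self _ _)
    rwa [map_inv₀, inv_lt_iff_one_lt_mul₀' (htpos v), ← map_one v.size] at this
  have hB' : ∀ v ∈ B, v.size t ≤ v.size (1 + x) := by
    intro v hv
    have h1 := (hB v hv).plus.le_size_add ht (a := 1) (b := x)
    rw [map_one, mul_one] at h1
    refine h1 ?_
    have := hxB v hv t⁻¹ (Finset.mem_insert_self _ _)
    rwa [map_inv₀, inv_mul_lt_iff₀ (htpos v), mul_one] at this
  have h0 : 1 + x ≠ 0 := by
    obtain ⟨v, hv⟩ := hne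
    exact (size_pos (v := v)).1 ((mul_pos (htpos v) (size_pos.2 hx0)).trans_le (hA' v hv))
  refine ⟨x / (1 + x), fun v hv c hc => ?_, fun v hv c hc => ?_⟩
  · have h1 : x / (1 + x) - 1 = -(1 / (1 + x)) := by field_simp; ring
    have h2 := hxA v hv (t⁻¹ * c) (Finset.mem_insert_of_mem (Finset.mem_image_of_mem _ hc))
    rw [map_mul, map_inv₀, inv_mul_lt_iff₀ (htpos v)] at h2
    rw [h1, size_neg, map_div₀, map_one, ← div_eq_mul_one_div, div_lt_one₀ (size_pos.2 h0)]
    exact h2.trans_le (hA' v hv)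
  · have h2 := hxB v hv (t⁻¹ * c) (Finset.mem_insert_of_mem (Finset.mem_image_of_mem _ hc))
    rw [map_mul, map_inv₀, mul_assoc, inv_mul_lt_iff₀ (htpos v), mul_one] at h2
    rw [map_div₀, ← mul_div_assoc, div_lt_one₀ (size_pos.2 h0)]
    exact h2.trans_le (hB' v hv)

/-- Simultaneous approximation of elements of `K` at finitely many almost uniform sets. -/
theorem exists_approximation {f : K[X]} {t : K} (ht : t ≠ 0) (hd : 2 ≤ f.natDegree)
    {ι : Type*} [Fintype ι] (P : ι → Set (Locality K)) (hP : ∀ i, ∀ v ∈ P i, Admissible f t v)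
    (hPu : ∀ i, AlmostUniform f t (P i)) (hne : ∀ i, (P i).Nonempty)
    (hI : ∀ i j, i ≠ j → ∀ v ∈ P i, ∀ w ∈ P j, Independent v w) (a : ι → K) (C : Finset K) :
    ∃ x : K, ∀ i, ∀ v ∈ P i, Small C v (x - a i) := by
  classical
  set N := (Finset.univ : Finset ι).card with hN
  -- `c * a j` absorbs the coefficients of the combination `∑ a j * e j`, and `t ^ N` the loss from
  -- adding N terms.
  let C' : Finset K := Finset.univ.biUnion fun j : ι => C.image fun c => (t ^ N)⁻¹ * (c * a j)
  have hC' : ∀ c ∈ C, ∀ j, (t ^ N)⁻¹ * (c * a j) ∈ C' := fun c hc j =>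
    Finset.mem_biUnion.2 ⟨j, Finset.mem_univ _, Finset.mem_image_of_mem _ hc⟩
  have hex : ∀ i, ∃ e : K, (∀ v ∈ P i, Small C' v (e - 1)) ∧
      ∀ j, j ≠ i → ∀ w ∈ P j, Small C' w e := by
    intro i
    obtain ⟨e, h1, h2⟩ := exists_near_one_near_zero ht hd (A := P i)
      (B := ⋃ j ∈ Finset.univ.erase i, P j) (hP i)
      (by
        intro v hv
        obtain ⟨j, -, hv⟩ := mem_iUnion₂.1 hv
        exact hP j v hv)
      (hPu i) (AlmostUniform.biUnion _ _ fun j _ => hPu j)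
      (by
        intro v hv w hw
        obtain ⟨j, hj, hw⟩ := mem_iUnion₂.1 hw
        exact hI i j (Finset.ne_of_mem_erase hj).symm v hv w hw) (hne i) C'
    exact ⟨e, h1, fun j hj w hw =>
      h2 w (mem_iUnion₂.2 ⟨j, Finset.mem_erase.2 ⟨hj, Finset.mem_univ _⟩, hw⟩)⟩
  choose e he1 he2 using hex
  refine ⟨∑ j, a j * e j, fun i v hv c hc => ?_⟩
  by_cases hc0 : c = 0
  · simp [hc0]
  have hsum : ∑ j, a j * e j - a i = ∑ j, a j * (if j = i then e j - 1 else e j) := by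
    have : ∀ j, a j * (if j = i then e j - 1 else e j) = a j * e j - if j = i then a j else 0 := by
      intro j
      split_ifs <;> ring
    simp only [this, Finset.sum_sub_distrib, Finset.sum_ite_eq', Finset.mem_univ, if_true]
  have hcpos := (size_pos (v := v)).2 hc0
  have htpos : 0 < v.size t ^ N := pow_pos (size_pos.2 ht) N
  have key := (hP i v hv).plus.size_sum_lt ht Finset.univ
    (fun j => a j * (if j = i then e j - 1 else e j)) (v.size c)⁻¹ (inv_pos.2 hcpos)
    (by
      intro j _
      have h1 : Small C' v (if j = i then e j - 1 else e j) := by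
        split_ifs with hj
        · exact hj ▸ he1 i v hv
        · exact he2 j i (Ne.symm hj) v hv
      have h2 := h1 _ (hC' c hc j)
      rw [map_mul, map_inv₀, map_pow, mul_assoc, inv_mul_lt_iff₀ htpos, mul_one, map_mul,
        mul_assoc, ← map_mul v.size (a j)] at h2
      rw [← hN, ← div_eq_mul_inv, lt_div_iff₀ hcpos, mul_comm]
      exact h2)
  rw [hsum, mul_comm, ← lt_div_iff₀ hcpos, one_div]
  exact key

/-- Sets satisfying the conclusion form a filter `G` containing all generators, so the generated
filter lies in `G`. No directedness of the generators is needed. -/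
theorem exists_finset_of_mem_iInf_principal {M Z s : Set K} (hZ : (0 : K) ∉ Z)
    (hs : s ∈ ⨅ z ∈ Z, 𝓟 (z • M)) :
    ∃ C : Finset K, ∀ d, (∀ c ∈ C, c * d ∈ M) → d ∈ s := by
  classical
  let G : Filter K :=
    { sets := {s | ∃ C : Finset K, ∀ d, (∀ c ∈ C, c * d ∈ M) → d ∈ s}
      univ_sets := ⟨∅, fun _ _ => mem_univ _⟩
      sets_of_superset := fun ⟨C, hC⟩ hst => ⟨C, fun d hd => hst (hC d hd)⟩
      inter_sets := fun ⟨C, hC⟩ ⟨C', hC'⟩ => ⟨C ∪ C', fun d hd =>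
        ⟨hC d fun c hc => hd c (Finset.mem_union_left _ hc),
          hC' d fun c hc => hd c (Finset.mem_union_right _ hc)⟩⟩ }
  have hG : G ≤ ⨅ z ∈ Z, 𝓟 (z • M) := by
    refine le_iInf₂ fun z hz => le_principal_iff.2 ⟨{z⁻¹}, fun d hd => ?_⟩
    have hz0 : z ≠ 0 := fun h => hZ (h ▸ hz)
    rw [Set.mem_smul_set_iff_inv_smul_mem₀ hz0]
    exact hd _ (Finset.mem_singleton_self _)
  exact hG hs

/-- By definition an open set belongs to the translated filter at each of its points; the filter
need not be known to be the neighbourhood filter. -/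
theorem exists_finset_of_isOpen_pi {M Z : Set K} (hZ : (0 : K) ∉ Z) {l : ℕ}
    {V : Set (Fin l → K)}
    (hV : IsOpen[@Pi.topologicalSpace (Fin l) (fun _ => K)
      (fun _ => translationTopology (⨅ z ∈ Z, 𝓟 (z • M)))] V) {p : Fin l → K} (hp : p ∈ V) :
    ∃ C : Finset K, ∀ x : Fin l → K, (∀ j, ∀ c ∈ C, c * (x j - p j) ∈ M) → x ∈ V := by
  classical
  obtain ⟨I, u, hu, hIu⟩ := (@isOpen_pi_iff (Fin l) (fun _ => K)
    (fun _ => translationTopology (⨅ z ∈ Z, 𝓟 (z • M))) V).1 hV p hp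
  have hex : ∀ j, ∃ C : Finset K, j ∈ I → ∀ d, (∀ c ∈ C, c * d ∈ M) → p j + d ∈ u j := by
    intro j
    by_cases hj : j ∈ I
    · have h1 : {d | p j + d ∈ u j} ∈ ⨅ z ∈ Z, 𝓟 (z • M) := (hu j hj).1 (p j) (hu j hj).2
      obtain ⟨C, hC⟩ := exists_finset_of_mem_iInf_principal hZ h1
      exact ⟨C, fun _ => hC⟩
    · exact ⟨∅, fun h => absurd h hj⟩
  choose C hC using hex
  refine ⟨Finset.univ.biUnion C, fun x hx => hIu fun j hj => ?_⟩
  have := hC j hj (x j - p j) fun c hc =>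
    hx j c (Finset.mem_biUnion.2 ⟨j, Finset.mem_univ _, hc⟩)
  rwa [add_sub_cancel] at this

theorem IsOpenAt.exists_finset {v : Locality K} {l : ℕ} {D : Set (Fin l → K)}
    (hD : v.IsOpenAt D) {p : Fin l → K} (hp : p ∈ D) :
    ∃ C : Finset K, ∀ x : Fin l → K, (∀ j, Small C v (x j - p j)) → x ∈ D := by
  obtain ⟨C, hC⟩ := exists_finset_of_isOpen_pi (Z := {z : K | z ≠ 0}) (by simp) hD hp
  refine ⟨C, fun x hx => hC x fun j c hc => mem_maximal_iff.2 ?_⟩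
  rw [map_mul]
  exact hx j c hc

theorem ContinuousFor.exists_finset {P : Set (Locality K)} {l m : ℕ} {D : Set (Fin l → K)}
    {g : D → (Fin m → K)} (hg : ContinuousFor P g) {U : Set (Fin m → K)}
    (hU : IsOpen[@Pi.topologicalSpace (Fin m) (fun _ => K) (fun _ => topologyOf P)] U)
    {p : D} (hp : g p ∈ U) :
    ∃ C : Finset K, ∀ x : D, (∀ j, ∀ v ∈ P, Small C v (x.1 j - p.1 j)) → g x ∈ U := by
  obtain ⟨V, hV, hVU⟩ := (@continuous_def _ _ _ _ g).1 hg U hU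
  have hpV : p.1 ∈ V := by
    have : p ∈ Subtype.val ⁻¹' V := by rw [hVU]; exact hp
    exact this
  obtain ⟨C, hC⟩ := exists_finset_of_isOpen_pi (Z := maximalOf P \ {0}) (by simp) hV hpV
  refine ⟨C, fun x hx => ?_⟩
  have hxV : x.1 ∈ V := hC x.1 fun j c hc => mem_maximalOf_iff.2 fun v hv => by
    rw [map_mul]
    exact hx j v hv c hc
  have : x ∈ Subtype.val ⁻¹' V := hxV
  rw [hVU] at this
  exact this

/-- `𝔪_P` is open at each of its points, uniformly in the localities in `P`. -/
def UniformlyOpen (P : Set (Locality K)) : Prop :=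
  ∀ a ∈ maximalOf P, ∃ C : Finset K, ∀ v ∈ P, ∀ x, Small C v x → v.size (a + x) < 1

theorem mem_ballOf_iff {P : Set (Locality K)} {m : ℕ} {y z p : Fin m → K} (hz : ∀ j, z j ≠ 0) :
    p ∈ ballOf P y z ↔ ∀ j, (z j)⁻¹ * (p j - y j) ∈ maximalOf P := by
  simp only [ballOf, mem_univ_pi, singleton_add, image_add_left, mem_preimage]
  refine forall_congr' fun j => ?_
  rw [Set.mem_smul_set_iff_inv_smul_mem₀ (hz j), smul_eq_mul, neg_add_eq_sub]

theorem UniformlyOpen.isOpen_ballOf {P : Set (Locality K)} (hP : UniformlyOpen P)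
    (hsmall : ∀ C : Finset K, ∃ q : K, q ≠ 0 ∧ ∀ v ∈ P, Small C v q) {m : ℕ} {y z : Fin m → K}
    (hz : ∀ j, z j ≠ 0) :
    IsOpen[@Pi.topologicalSpace (Fin m) (fun _ => K) (fun _ => topologyOf P)] (ballOf P y z) := by
  classical
  refine @isOpen_set_pi (Fin m) (fun _ => K) (fun _ => topologyOf P) univ _ finite_univ
    fun j _ => ?_
  intro a ha
  simp only [singleton_add, image_add_left, mem_preimage] at ha
  rw [Set.mem_smul_set_iff_inv_smul_mem₀ (hz j), smul_eq_mul, neg_add_eq_sub] at ha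
  obtain ⟨C, hC⟩ := hP _ ha
  -- For such `q` the translate `a + q 𝔪_P` stays in the ball: the division by `z j` is built into
  -- the thresholds, and the threshold 1 puts `q` in `𝔪_P`.
  obtain ⟨q, hq0, hq⟩ := hsmall (insert 1 (C.image fun c => c * (z j)⁻¹))
  have hqm : q ∈ maximalOf P := mem_maximalOf_iff.2 fun v hv => by
    simpa using hq v hv 1 (Finset.mem_insert_self _ _)
  refine Filter.mem_map.2 (Filter.mem_of_superset (x := q • maximalOf P)
    (mem_iInf_of_mem q (mem_iInf_of_mem ⟨hqm, hq0⟩ (mem_principal_self _))) ?_)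
  rintro _ ⟨d, hd, rfl⟩
  simp only [singleton_add, image_add_left, mem_preimage, smul_eq_mul]
  rw [Set.mem_smul_set_iff_inv_smul_mem₀ (hz j), smul_eq_mul, mem_maximalOf_iff]
  intro v hv
  have h1 : (z j)⁻¹ * (-y j + (a + q * d)) = (z j)⁻¹ * (a - y j) + (z j)⁻¹ * (q * d) := by ring
  rw [h1]
  refine hC v hv _ fun c hc => ?_
  have h2 := hq v hv (c * (z j)⁻¹) (Finset.mem_insert_of_mem (Finset.mem_image_of_mem _ hc))
  have h3 := mem_maximalOf_iff.1 hd v hv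
  calc v.size c * v.size ((z j)⁻¹ * (q * d))
      = v.size (c * (z j)⁻¹) * v.size q * v.size d := by simp only [map_mul, mul_assoc]
    _ < 1 := mul_lt_one_of_lt_of_le h2 h3.le

end Locality

/-! ### Archimedean absolute values: embeddings into ℝ or ℂ -/

namespace AbsoluteValue

variable {K : Type u} [Field K]

/-- The restriction of an absolute value to the rationals. -/
noncomputable def restrictRat [CharZero K] (a : AbsoluteValue K ℝ) : AbsoluteValue ℚ ℝ where
  toFun q := a q
  map_mul' x y := by push_cast; exact map_mul a _ _
  nonneg' _ := a.nonneg _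
  eq_zero' _ := by rw [a.eq_zero, Rat.cast_eq_zero]
  add_le' x y := by push_cast; exact a.add_le _ _

/-- In characteristic p a nonzero integer is a root of unity by Fermat, hence of absolute value 1.
-/
theorem charZero_of_one_lt_natCast (a : AbsoluteValue K ℝ) {n : ℕ} (hn : 1 < a n) :
    CharZero K := by
  obtain ⟨p, hp⟩ := CharP.exists K
  rcases CharP.char_is_prime_or_zero K p with hpp | rfl
  · exfalso
    have := Fact.mk hpp
    have hn0 : ((n : ZMod p)) ≠ 0 := by
      intro h
      have h2 : (n : K) = 0 := by
        rw [CharP.cast_eq_zero_iff K p]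
        exact (ZMod.natCast_eq_zero_iff n p).1 h
      rw [h2, map_zero] at hn
      exact absurd hn (by norm_num)
    have h1 : (n : ZMod p) ^ (p - 1) = 1 := ZMod.pow_card_sub_one_eq_one hn0
    have h2 : (n : K) ^ (p - 1) = 1 := by
      have := congrArg (ZMod.castHom (dvd_refl p) K) h1
      simpa using this
    have h3 : a n ^ (p - 1) = 1 := by rw [← map_pow, h2, map_one]
    exact absurd h3 (one_lt_pow₀ hn (by have := hpp.two_le; omega)).ne'
  · exact CharP.charP_to_charZero K

theorem exists_one_lt_natCast (a : AbsoluteValue K ℝ) (ha : ¬ IsNonarchimedean a) :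
    ∃ n : ℕ, 1 < a n := by
  by_contra! h
  have : IsUltrametricDist (WithAbs a) :=
    IsUltrametricDist.isUltrametricDist_of_forall_norm_natCast_le_one fun n => h n
  exact ha fun x y => IsUltrametricDist.norm_add_le_max (WithAbs.toAbs a x) (WithAbs.toAbs a y)

/-- A crude bound of all terms by the largest one; its factor is harmless in `rpow_add_le`, where
the number of terms grows only linearly with the exponent. -/
theorem sum_rpow_le {ι : Type*} (s : Finset ι) (w : ι → ℝ) (hw : ∀ i ∈ s, 0 ≤ w i) {c : ℝ}
    (hc : 0 < c) : (∑ i ∈ s, w i) ^ c ≤ (s.card : ℝ) ^ c * ∑ i ∈ s, w i ^ c := by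
  rcases s.eq_empty_or_nonempty with rfl | hs
  · simp [Real.zero_rpow hc.ne']
  obtain ⟨k, hk, hmax⟩ := s.exists_max_image w hs
  calc (∑ i ∈ s, w i) ^ c ≤ (s.card * w k) ^ c := by
        refine Real.rpow_le_rpow (Finset.sum_nonneg hw) ?_ hc.le
        simpa using Finset.sum_le_card_nsmul s w (w k) hmax
    _ = (s.card : ℝ) ^ c * w k ^ c := Real.mul_rpow (Nat.cast_nonneg _) (hw k hk)
    _ ≤ _ := by
        gcongr
        exact Finset.single_le_sum (f := fun i => w i ^ c)
          (fun i hi => Real.rpow_nonneg (hw i hi) c) hk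

/-- If a power of an absolute value is the standard one on the natural numbers, then it is
an absolute value. -/
theorem rpow_add_le (a : AbsoluteValue K ℝ) {c : ℝ} (hc : 0 < c)
    (h : ∀ n : ℕ, a n ^ c = n) (x y : K) : a (x + y) ^ c ≤ a x ^ c + a y ^ c := by
  by_contra! hlt
  set X := a x ^ c with hX
  set Y := a y ^ c with hY
  set Z := a (x + y) ^ c with hZ
  have hX0 : 0 ≤ X := Real.rpow_nonneg (a.nonneg _) _
  have hY0 : 0 ≤ Y := Real.rpow_nonneg (a.nonneg _) _
  have hZ0 : 0 < Z := (add_nonneg hX0 hY0).trans_lt hlt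
  have hpow : ∀ (u : K) (k : ℕ), a (u ^ k) ^ c = (a u ^ c) ^ k := fun u k => by
    rw [map_pow, ← Real.rpow_natCast, ← Real.rpow_natCast, ← Real.rpow_mul (a.nonneg _),
      ← Real.rpow_mul (a.nonneg _), mul_comm]
  -- Expand `(x + y) ^ n` binomially: the binomial coefficients have their usual size, so the sum
  -- reassembles to `(X + Y) ^ n`. If Z > X + Y, the geometric decay of `((X + Y)/Z) ^ n` beats the
  -- polynomial factor.
  have hbound : ∀ n : ℕ, Z ^ n ≤ ((n : ℝ) + 1) ^ c * (X + Y) ^ n := by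
    intro n
    calc Z ^ n = a ((x + y) ^ n) ^ c := (hpow _ _).symm
      _ ≤ (∑ k ∈ Finset.range (n + 1), a (x ^ k * y ^ (n - k) * (n.choose k))) ^ c := by
          refine Real.rpow_le_rpow (a.nonneg _) ?_ hc.le
          rw [add_pow]
          exact a.sum_le _ _
      _ ≤ ((Finset.range (n + 1)).card : ℝ) ^ c *
            ∑ k ∈ Finset.range (n + 1), a (x ^ k * y ^ (n - k) * (n.choose k)) ^ c :=
          sum_rpow_le _ _ (fun _ _ => a.nonneg _) hc
      _ = _ := by
          rw [Finset.card_range, add_pow X Y]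
          push_cast
          congr 1
          refine Finset.sum_congr rfl fun k _ => ?_
          rw [map_mul, map_mul, Real.mul_rpow (mul_nonneg (a.nonneg _) (a.nonneg _))
            (a.nonneg _), Real.mul_rpow (a.nonneg _) (a.nonneg _), hpow, hpow, h]
  set q := (X + Y) / Z with hq
  have hq0 : 0 ≤ q := div_nonneg (add_nonneg hX0 hY0) hZ0.le
  have hq1 : q < 1 := (div_lt_one hZ0).2 hlt
  obtain ⟨k, hk⟩ := exists_nat_ge c
  have hq2 : ∀ n : ℕ, 1 ≤ ((n : ℝ) + 1) ^ k * q ^ n := by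
    intro n
    have h1 : 1 ≤ ((n : ℝ) + 1) ^ c * q ^ n := by
      rw [hq, div_pow, ← mul_div_assoc, one_le_div (pow_pos hZ0 n)]
      exact hbound n
    refine h1.trans ?_
    gcongr
    rw [← Real.rpow_natCast]
    exact Real.rpow_le_rpow_of_exponent_le (by linarith [n.cast_nonneg (α := ℝ)]) hk
  have hlim : Tendsto (fun n : ℕ => ((n : ℝ) + 1) ^ k * q ^ n) atTop (𝓝 0) := by
    have h2 : Tendsto (fun n : ℕ => (2 : ℝ) ^ k * ((n : ℝ) ^ k * q ^ n)) atTop (𝓝 0) := by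
      simpa using (tendsto_pow_const_mul_const_pow_of_abs_lt_one k
        (by rwa [abs_of_nonneg hq0])).const_mul ((2 : ℝ) ^ k)
    refine squeeze_zero' (Eventually.of_forall fun n => by positivity)
      ((eventually_ge_atTop 1).mono fun n hn => ?_) h2
    rw [← mul_assoc, ← mul_pow]
    have : (1 : ℝ) ≤ n := by exact_mod_cast hn
    gcongr
    linarith
  exact absurd (ge_of_tendsto' hlim hq2) (by norm_num)

/-- An archimedean absolute value has a power that is an absolute value extending the standard
one on the rationals. -/
theorem exists_rpow_extends_real (a : AbsoluteValue K ℝ) (ha : ¬ IsNonarchimedean a) :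
    ∃ (c : ℝ) (b : AbsoluteValue K ℝ), 0 < c ∧ (∀ x, a x ^ c = b x) ∧
      ∀ q : ℚ, b q = |(q : ℝ)| := by
  obtain ⟨n, hn⟩ := a.exists_one_lt_natCast ha
  have := a.charZero_of_one_lt_natCast hn
  have hun : ¬ ∀ n : ℕ, a.restrictRat n ≤ 1 := by
    push Not
    refine ⟨n, ?_⟩
    change 1 < a ((n : ℚ) : K)
    rwa [Rat.cast_natCast]
  -- Ostrowski's theorem for ℚ.
  have hequiv := Rat.AbsoluteValue.equiv_real_of_unbounded hun
  obtain ⟨c, hc, h⟩ := isEquiv_iff_exists_rpow_eq.1 hequiv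
  have hrat : ∀ q : ℚ, a q ^ c = |(q : ℝ)| := fun q => by
    have := congrFun h q
    simpa [restrictRat] using this
  refine ⟨c, ⟨⟨fun x => a x ^ c, fun x y => ?_⟩, fun x => Real.rpow_nonneg (a.nonneg _) _,
    fun x => ?_, ?_⟩, hc, fun x => rfl, hrat⟩
  · rw [map_mul, Real.mul_rpow (a.nonneg _) (a.nonneg _)]
  · rw [Real.rpow_eq_zero (a.nonneg _) hc.ne', a.eq_zero]
  · refine a.rpow_add_le hc fun n => ?_
    have := hrat n
    simpa using this

end AbsoluteValue

/-- A complete normed field in which rationals have their usual norm is a real algebra. -/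
theorem exists_ringHom_real_norm_eq (F : Type*) [NormedField F] [CompleteSpace F] [CharZero F]
    (h : ∀ q : ℚ, ‖(q : F)‖ = |(q : ℝ)|) : ∃ φ : ℝ →+* F, ∀ r, ‖φ r‖ = ‖r‖ := by
  have hiso : Isometry (Rat.castHom F) := by
    refine Isometry.of_dist_eq fun p q => ?_
    rw [dist_eq_norm, ← map_sub, eq_ratCast, h, Rat.dist_eq]
    push_cast
    rfl
  have ue : IsUniformInducing (Rat.castHom ℝ) := by
    have := Rat.isUniformEmbedding_coe_real.isUniformInducing
    exact this
  have dr : DenseRange (Rat.castHom ℝ) := Rat.isDenseEmbedding_coe_real.dense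
  have hf := hiso.uniformContinuous
  refine ⟨IsDenseInducing.extendRingHom ue dr hf, fun r => ?_⟩
  have hcont : Continuous (IsDenseInducing.extendRingHom ue dr hf) :=
    (uniformContinuous_uniformly_extend ue dr hf).continuous
  refine DenseRange.induction_on dr r ?_ fun q => ?_
  · exact isClosed_eq hcont.norm continuous_norm
  · have : IsDenseInducing.extendRingHom ue dr hf (Rat.castHom ℝ q) = Rat.castHom F q :=
      IsDenseInducing.extend_eq (ue.isDenseInducing dr) hf.continuous q
    rw [this, eq_ratCast, eq_ratCast, h, Real.norm_eq_abs]

/-- A linear map in finite dimension is bounded. Multiplicativity of the norms lets the bound be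
applied to powers of `x`, which reduces the constant to 1. -/
theorem norm_algEquiv_le {E E' : Type*} [NormedField E] [NormedAlgebra ℝ E] [NormedField E']
    [NormedAlgebra ℝ E'] [FiniteDimensional ℝ E] (g : E ≃ₐ[ℝ] E') (x : E) : ‖g x‖ ≤ ‖x‖ := by
  obtain ⟨C, hC0, hC⟩ := (LinearMap.toContinuousLinearMap g.toLinearMap).bound
  have hpow : ∀ n : ℕ, ‖g x‖ ^ n ≤ C * ‖x‖ ^ n := fun n => by
    rw [← norm_pow, ← norm_pow, ← map_pow]
    exact hC (x ^ n)
  by_cases hx : x = 0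
  · simp [hx]
  by_contra! hlt
  have h0 : 0 < ‖x‖ := norm_pos_iff.2 hx
  obtain ⟨n, hn⟩ := pow_unbounded_of_one_lt C ((one_lt_div h0).2 hlt)
  rw [div_pow, lt_div_iff₀ (pow_pos h0 n)] at hn
  exact absurd (hpow n) (not_le.2 hn)

/-- Isomorphisms of normed fields that are finite-dimensional real algebras are isometric. -/
theorem norm_algEquiv_eq {E E' : Type*} [NormedField E] [NormedAlgebra ℝ E] [NormedField E']
    [NormedAlgebra ℝ E'] [FiniteDimensional ℝ E'] (g : E ≃ₐ[ℝ] E') (x : E) : ‖g x‖ = ‖x‖ := by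
  have : FiniteDimensional ℝ E := Module.Finite.equiv g.symm.toLinearEquiv
  refine le_antisymm (norm_algEquiv_le g x) ?_
  simpa using norm_algEquiv_le g.symm (g x)

/-- After normalization on ℚ the completion is a normed field over ℝ, hence ℝ or ℂ by Gelfand–Mazur.
Density in the complex case carries bounds on polynomial values from `K` over to ℂ. -/
theorem AbsoluteValue.exists_embedding {K : Type u} [Field K] (a : AbsoluteValue K ℝ)
    (ha : ¬ IsNonarchimedean a) :
    ∃ c : ℝ, 0 < c ∧ ((∃ φ : K →+* ℝ, ∀ x, a x ^ c = ‖φ x‖) ∨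
      ∃ φ : K →+* ℂ, DenseRange φ ∧ ∀ x, a x ^ c = ‖φ x‖) := by
  obtain ⟨n, hn⟩ := a.exists_one_lt_natCast ha
  have := a.charZero_of_one_lt_natCast hn
  obtain ⟨c, b, hc, hab, hb⟩ := a.exists_rpow_extends_real ha
  refine ⟨c, hc, ?_⟩
  let F := b.Completion
  let ι : K →+* F :=
    (UniformSpace.Completion.coeRingHom (α := WithAbs b)).comp
      (WithAbs.equiv b).symm.toRingHom
  have hι : ∀ x, ‖ι x‖ = b x := fun x => UniformSpace.Completion.norm_coe _
  have hd : DenseRange ι := by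
    refine (UniformSpace.Completion.denseRange_coe (α := WithAbs b)).mono ?_
    rintro _ ⟨x, rfl⟩
    exact ⟨WithAbs.equiv b x, rfl⟩
  have : CharZero F := charZero_of_injective_ringHom ι.injective
  obtain ⟨ρ, hρ⟩ := exists_ringHom_real_norm_eq F fun q => by
    rw [← hb, ← hι, map_ratCast]
  let _ : NormedAlgebra ℝ F :=
    { ρ.toAlgebra with
      norm_smul_le := fun r x => by
        change ‖ρ r * x‖ ≤ _
        rw [norm_mul, hρ] }
  rcases NormedAlgebra.Real.nonempty_algEquiv_or F with ⟨⟨e⟩⟩ | ⟨⟨e⟩⟩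
  · left
    refine ⟨(e : F →+* ℝ).comp ι, fun x => ?_⟩
    rw [hab, ← hι]
    exact (norm_algEquiv_eq e (ι x)).symm
  · right
    refine ⟨(e : F →+* ℂ).comp ι, ?_, fun x => ?_⟩
    · have he : Isometry e := AddMonoidHomClass.isometry_of_norm e (norm_algEquiv_eq e)
      exact e.surjective.denseRange.comp hd he.continuous
    · rw [hab, ← hι]
      exact (norm_algEquiv_eq e (ι x)).symm

/-! ### Openness of balls, uniformly over sets of localities -/

namespace Locality

variable {K : Type u} [Field K]

theorem Small.size_lt_one {v : Locality K} {C : Finset K} {x : K} (h : Small C v x)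
    (hC : 1 ∈ C) : v.size x < 1 := by
  simpa using h 1 hC

/-- The thresholds below which an element can be added to `a`, at any real locality at which
`a` has size less than one. -/
noncomputable def realThresholds (a : K) : Finset K :=
  open Classical in {1, (1 - a)⁻¹, (1 + a)⁻¹}

/-- In an ordered field, |a + x| < 1 follows from |x| < 1 - a and |x| < 1 + a. These thresholds
depend on `a` alone, not on `v`. -/
theorem size_add_lt_one_of_ringHom {v : Locality K} {L : Type*} [Field L] [LinearOrder L]
    [IsStrictOrderedRing L] (φ : K →+* L) (h : ∀ x, v.size x < 1 ↔ |φ x| < 1) {a x : K}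
    (ha : v.size a < 1) (hx : Small (realThresholds a) v x) : v.size (a + x) < 1 := by
  rw [h, abs_lt] at ha
  have h1 : 0 < 1 - φ a := by linarith [ha.2]
  have h2 : 0 < 1 + φ a := by linarith [ha.1]
  have hx1 := hx (1 - a)⁻¹ (by simp [realThresholds])
  have hx2 := hx (1 + a)⁻¹ (by simp [realThresholds])
  rw [← map_mul, h, map_mul, map_inv₀, abs_mul, abs_inv] at hx1 hx2
  rw [map_sub, map_one, abs_of_pos h1, inv_mul_lt_iff₀ h1, mul_one, abs_lt] at hx1
  rw [map_add, map_one, abs_of_pos h2, inv_mul_lt_iff₀ h2, mul_one, abs_lt] at hx2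
  rw [h, map_add, abs_lt]
  constructor <;> linarith [hx1.1, hx1.2, hx2.1, hx2.2]

theorem size_add_lt_one_of_ordering {v : Locality K} (L : LinearOrder K)
    (hL : IsStrictOrderedRing K) (hv : v.1 = UnitBall.ofOrdering L hL) {a x : K}
    (ha : v.size a < 1) (hx : Small (realThresholds a) v x) : v.size (a + x) < 1 := by
  refine size_add_lt_one_of_ringHom (RingHom.id K) (fun x => ?_) ha hx
  rw [← mem_maximal_iff, RingHom.id_apply, abs_lt]
  unfold maximal
  rw [hv]
  exact UnitBall.mem_maximal_ofOrdering L hL x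

theorem size_add_lt_one_of_valuation {v : Locality K} (A : ValuationSubring K)
    (hv : v.1 = UnitBall.ofValuationSubring A) {a x : K} (ha : v.size a < 1)
    (hx : v.size x < 1) : v.size (a + x) < 1 := by
  have h : ∀ x, v.size x < 1 ↔ A.valuation x < 1 := fun x => by
    rw [← mem_maximal_iff]
    unfold maximal
    rw [hv, ← UnitBall.mem_maximal_ofValuation, ValuationSubring.valuationSubring_valuation]
  rw [h] at *
  exact (A.valuation.map_add _ _).trans_lt (max_lt ha hx)

theorem size_lt_one_iff_of_absoluteValue {v : Locality K} {b : AbsoluteValue K ℝ}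
    (hv : v.1 = UnitBall.ofAbsoluteValue b) (x : K) : v.size x < 1 ↔ b x < 1 := by
  rw [← mem_maximal_iff]
  unfold maximal
  rw [hv]
  exact UnitBall.mem_maximal_ofAbsoluteValue b x

/-- Comparing `x` and `y` amounts to locating `y / x` relative to the unit ball, so the unit ball
determines the whole order of sizes. -/
theorem size_le_size_iff_of_absoluteValue {v : Locality K} {b : AbsoluteValue K ℝ}
    (hv : v.1 = UnitBall.ofAbsoluteValue b) (x y : K) : v.size x ≤ v.size y ↔ b x ≤ b y := by
  by_cases hx : x = 0
  · simp [hx]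
  have := size_lt_one_iff_of_absoluteValue hv (y / x)
  rw [map_div₀, map_div₀, div_lt_one₀ (size_pos.2 hx), div_lt_one₀ (b.pos hx)] at this
  rw [← not_lt, ← not_lt, this]

/-- The unit ball of any nontrivial locality is open at each point of its interior. -/
theorem exists_size_add_lt_one {v : Locality K} (hv : v ≠ trivial K) {a : K}
    (ha : v.size a < 1) : ∃ C : Finset K, ∀ x, Small C v x → v.size (a + x) < 1 := by
  classical
  rcases v.2 with ⟨A, hA⟩ | ⟨L, hL, h⟩ | ⟨b, hb⟩
  · exact ⟨{1}, fun x hx => size_add_lt_one_of_valuation A hA ha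
      (Small.size_lt_one hx (by simp))⟩
  · exact ⟨_, fun x hx => size_add_lt_one_of_ordering L hL h ha hx⟩
  · have hlt := size_lt_one_iff_of_absoluteValue hb
    obtain ⟨g, hg⟩ := exists_one_lt_size hv
    have hg' : 1 < b g := by
      have := size_le_size_iff_of_absoluteValue hb g 1
      rw [map_one, map_one] at this
      exact not_le.1 fun h => not_le.2 hg (this.2 h)
    rw [hlt] at ha
    -- A power of `g` serves as threshold making `b x` smaller than `1 - b a`; it depends on the
    -- locality.
    obtain ⟨n, hn⟩ := pow_unbounded_of_one_lt ((1 - b a)⁻¹) hg'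
    refine ⟨{g ^ n}, fun x hx => ?_⟩
    have h1 := hx (g ^ n) (by simp)
    rw [← map_mul, hlt, map_mul, map_pow] at h1
    rw [hlt]
    have h2 : 0 < 1 - b a := by linarith
    have h3 : b x < 1 - b a := by
      have h4 : b x ≤ (1 - b a) * (b g ^ n * b x) := by
        rw [← mul_assoc]
        refine le_mul_of_one_le_left (b.nonneg _) ?_
        rw [inv_lt_iff_one_lt_mul₀' h2] at hn
        exact hn.le
      exact h4.trans_lt (mul_lt_of_lt_one_right h2 h1)
    linarith [b.add_le a x]

theorem size_le_size_eval {f : K[X]} {t : K} {v : Locality K} (ht : t ≠ 0)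
    (h : CondLeadingTerm f t v) (h' : CondNoApproxZero f t v) (x : K) :
    v.size t ≤ v.size (f.eval x) := by
  rcases le_or_gt (v.size x) 1 with hx | hx
  · exact not_lt.1 fun hlt => h' x (mem_ball_iff.2 hx) ((mem_smul_maximal_iff ht).2 hlt)
  · obtain ⟨w, hw, htw, -⟩ := h.exists_eval ht hx
    rw [hw, map_mul, map_pow]
    exact htw.trans (le_mul_of_one_le_left' (one_le_pow₀ hx.le))

/-- The absence of approximate zeros excludes complex absolute values. -/
theorem CondNoApproxZero.not_complex {f : K[X]} {t : K} {v : Locality K} (ht : t ≠ 0)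
    (hd : 2 ≤ f.natDegree) (h : CondLeadingTerm f t v) (h' : CondNoApproxZero f t v)
    {b : AbsoluteValue K ℝ} (hv : v.1 = UnitBall.ofAbsoluteValue b) {c : ℝ} (hc : 0 < c)
    (φ : K →+* ℂ) (hφ : DenseRange φ) (hb : ∀ x, b x ^ c = ‖φ x‖) : False := by
  -- The lower bound |t| ≤ |f(x)| on `K` extends by density to all of ℂ, contradicting the existence
  -- of a root.
  have hle : ∀ z : ℂ, ‖φ t‖ ≤ ‖(f.map φ).eval z‖ := by
    intro z
    refine hφ.induction_on z ?_ fun x => ?_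
    · exact isClosed_le continuous_const (f.map φ).continuous.norm
    · rw [Polynomial.eval_map_apply, ← hb, ← hb]
      refine Real.rpow_le_rpow (b.nonneg _) ?_ hc.le
      exact (size_le_size_iff_of_absoluteValue hv _ _).1 (size_le_size_eval ht h h' x)
  obtain ⟨z, hz⟩ := Complex.exists_root (f := f.map φ) (by
    rw [Polynomial.degree_map]
    exact Polynomial.natDegree_pos_iff_degree_pos.1 (by omega))
  have := hle z
  rw [hz.eq_zero, norm_zero, norm_le_zero_iff, map_eq_zero] at this
  exact ht this

/-- Once complex absolute values are excluded, every locality is ultrametric or comes from an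
embedding into an ordered field, and the same thresholds work for all. -/
theorem size_add_lt_one {f : K[X]} {t : K} {v : Locality K} (ht : t ≠ 0)
    (hd : 2 ≤ f.natDegree) (h : CondLeadingTerm f t v) (h' : CondNoApproxZero f t v) {a x : K}
    (ha : v.size a < 1) (hx : Small (realThresholds a) v x) : v.size (a + x) < 1 := by
  rcases v.2 with ⟨A, hA⟩ | ⟨L, hL, hv⟩ | ⟨b, hb⟩
  · exact size_add_lt_one_of_valuation A hA ha (Small.size_lt_one hx (by simp [realThresholds]))
  · exact size_add_lt_one_of_ordering L hL hv ha hx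
  · have hlt := size_lt_one_iff_of_absoluteValue hb
    by_cases hna : IsNonarchimedean b
    · have hx1 := Small.size_lt_one hx (by simp [realThresholds])
      rw [hlt] at *
      exact (hna a x).trans_lt (max_lt ha hx1)
    · obtain ⟨c, hc, ⟨φ, hφ⟩ | ⟨φ, hd', hφ⟩⟩ := b.exists_embedding hna
      · refine size_add_lt_one_of_ringHom φ (fun x => ?_) ha hx
        rw [hlt, ← Real.norm_eq_abs, ← hφ]
        exact (Real.rpow_lt_one_iff' (b.nonneg _) hc).symm
      · exact (h'.not_complex ht hd h hb hc φ hd' hφ).elim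

theorem uniformlyOpen_of_condNoApproxZero {f : K[X]} {t : K} (ht : t ≠ 0)
    (hd : 2 ≤ f.natDegree) {P : Set (Locality K)} (hP : ∀ v ∈ P, CondLeadingTerm f t v)
    (hP' : ∀ v ∈ P, CondNoApproxZero f t v) : UniformlyOpen P := by
  classical
  intro a ha
  exact ⟨realThresholds a, fun v hv x hx =>
    size_add_lt_one ht hd (hP v hv) (hP' v hv) (mem_maximalOf_iff.1 ha v hv) hx⟩

theorem uniformlyOpen_of_finite {P : Set (Locality K)} (hfin : P.Finite)
    (hP : ∀ v ∈ P, v ≠ trivial K) : UniformlyOpen P := by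
  classical
  intro a ha
  have hex : ∀ v : Locality K, ∃ C : Finset K, v ∈ P → ∀ x, Small C v x → v.size (a + x) < 1 := by
    intro v
    by_cases hv : v ∈ P
    · obtain ⟨C, hC⟩ := exists_size_add_lt_one (hP v hv) (mem_maximalOf_iff.1 ha v hv)
      exact ⟨C, fun _ => hC⟩
    · exact ⟨∅, fun h => absurd h hv⟩
  choose C hC using hex
  exact ⟨hfin.toFinset.biUnion C, fun v hv x hx => hC v hv x
    (hx.mono (Finset.subset_biUnion_of_mem C (hfin.mem_toFinset.2 hv)))⟩

end Locality

/-! ### Partition into compact pieces, and the main theorem -/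

/-- A compact set covered by clopen sets has a finite partition into compact pieces, each
contained in a member of the cover. -/
theorem IsCompact.exists_finset_partition {X : Type*} [TopologicalSpace X] {S : Set X}
    (hS : IsCompact S) {α : Type*} (V : α → Set X) (hV : ∀ a, IsClopen (V a))
    (hSV : S ⊆ ⋃ a, V a) :
    ∃ F : Finset (Set X), (∀ P ∈ F, P ⊆ S ∧ P.Nonempty ∧ IsCompact P ∧ ∃ a, P ⊆ V a) ∧
      (∀ P ∈ F, ∀ Q ∈ F, P ≠ Q → Disjoint P Q) ∧ ∀ x ∈ S, ∃ P ∈ F, x ∈ P := by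
  classical
  obtain ⟨J, hJ⟩ := hS.elim_finite_subcover V (fun a => (hV a).isOpen) hSV
  clear hSV
  induction J using Finset.induction_on generalizing S with
  | empty =>
    have : S = ∅ := subset_empty_iff.1 (by simpa using hJ)
    exact ⟨∅, by simp, by simp, by simp [this]⟩
  | insert a J ha ih =>
    -- Removing the open set `V a` keeps the rest compact; the piece `S ∩ V a` is compact because `V
    -- a` is also closed.
    obtain ⟨F, h1, h2, h3⟩ := ih (S := S \ V a) (hS.diff (hV a).isOpen) fun x hx => by
      have := hJ hx.1
      rw [Finset.set_biUnion_insert] at this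
      exact this.resolve_left hx.2
    rcases (S ∩ V a).eq_empty_or_nonempty with he | hne
    · refine ⟨F, fun P hP => ⟨(h1 P hP).1.trans sdiff_subset, (h1 P hP).2⟩, h2,
        fun x hx => h3 x ⟨hx, fun hxa => ?_⟩⟩
      exact (he ▸ ⟨hx, hxa⟩ : x ∈ (∅ : Set X))
    have hdisj : ∀ P ∈ F, Disjoint (S ∩ V a) P := fun P hP =>
      Set.disjoint_left.2 fun x hx hxP => ((h1 P hP).1 hxP).2 hx.2
    refine ⟨insert (S ∩ V a) F, ?_, ?_, ?_⟩
    · intro P hP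
      rcases Finset.mem_insert.1 hP with rfl | hP
      · exact ⟨inter_subset_left, hne, hS.inter_right (hV a).isClosed, a, inter_subset_right⟩
      · exact ⟨(h1 P hP).1.trans sdiff_subset, (h1 P hP).2⟩
    · intro P hP Q hQ hPQ
      rcases Finset.mem_insert.1 hP with rfl | hP <;> rcases Finset.mem_insert.1 hQ with rfl | hQ
      · exact absurd rfl hPQ
      · exact hdisj Q hQ
      · exact (hdisj P hP).symm
      · exact h2 P hP Q hQ hPQ
    · intro x hx
      by_cases hxa : x ∈ V a
      · exact ⟨_, Finset.mem_insert_self _ _, hx, hxa⟩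
      · obtain ⟨P, hP, hxP⟩ := h3 x ⟨hx, hxa⟩
        exact ⟨P, Finset.mem_insert_of_mem hP, hxP⟩

namespace Locality

variable {K : Type u} [Field K]

/-- The constructible topology is finer, so the pieces qualify for hereditary continuity. -/
theorem isCompact_zariskiDual {P : Set (Locality K)}
    (h : @IsCompact _ (constructibleTopology K) P) :
    @IsCompact _ (zariskiDualTopology K) P := by
  have hle : constructibleTopology K ≤ zariskiDualTopology K :=
    induced_mono (TopologicalSpace.generateFrom_anti subset_union_right)
  have := @IsCompact.image _ _ (constructibleTopology K) (zariskiDualTopology K) P id h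
    (continuous_id_iff_le.2 hle)
  rwa [image_id] at this

theorem mem_ballAt_iff {v : Locality K} {m : ℕ} {y z p : Fin m → K} (hz : ∀ j, z j ≠ 0) :
    p ∈ v.ballAt y z ↔ ∀ j, (z j)⁻¹ * (p j - y j) ∈ v.maximal := by
  simp only [ballAt, mem_ballOf_iff hz, mem_maximalOf_iff, mem_maximal_iff, mem_singleton_iff,
    forall_eq]

theorem mem_ballOf_iff_forall {P : Set (Locality K)} {m : ℕ} {y z p : Fin m → K}
    (hz : ∀ j, z j ≠ 0) : p ∈ ballOf P y z ↔ ∀ v ∈ P, p ∈ v.ballAt y z := by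
  simp only [mem_ballAt_iff hz, mem_ballOf_iff hz, mem_maximalOf_iff, mem_maximal_iff]
  exact ⟨fun h v hv j => h j v hv, fun h j v hv => h v hv j⟩

theorem isClopen_setOf_mem_ballAt {m : ℕ} {y z : Fin m → K} (hz : ∀ j, z j ≠ 0)
    (p : Fin m → K) :
    @IsClopen _ (constructibleTopology K) {v : Locality K | p ∈ v.ballAt y z} := by
  let _ := constructibleTopology K
  have : {v : Locality K | p ∈ v.ballAt y z} =
      ⋂ j, {v : Locality K | (z j)⁻¹ * (p j - y j) ∈ v.maximal} := by
    ext v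
    simp only [mem_ofPred_eq, mem_iInter, mem_ballAt_iff hz]
  rw [this]
  exact isClopen_iInter_of_finite fun j =>
    ⟨isClosed_setOf_mem_maximal _, isOpen_setOf_mem_maximal _⟩

end Locality

theorem mainTheorem6 {K : Type u} [Field K] {n m l : ℕ} (hn : 0 < n)
    (S : Fin n → Set (Locality K)) (t : K) (ht : t ≠ 0)
    (y z : Fin n → Fin m → K) (hz : ∀ i j, z i j ≠ 0)
    (hS_nontrivial : ∀ i, Locality.trivial K ∉ S i)
    (hS_nonempty : ∀ i, (S i).Nonempty)
    (hS_disjoint : Pairwise (fun i j => Disjoint (S i) (S j)))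
    (hU : Locality.UniformityAssumption S t)
    (hT : ∀ i, @IsCompact _ (Locality.constructibleTopology K) (S i))
    (hI : (⋃ i, S i).Pairwise Locality.Independent)
    (D : Set (Fin l → K)) (hD : ∀ v ∈ ⋃ i, S i, v.IsOpenAt D)
    (g : D → (Fin m → K)) (hg : ∀ i, Locality.HereditarilyContinuous (S i) g)
    (hloc : ∀ i, ∀ v ∈ S i, ∃ x : D, g x ∈ v.ballAt (y i) (z i)) :
    ∃ x : D, ∀ i, ∀ v ∈ S i, g x ∈ v.ballAt (y i) (z i) := by
  classical
  obtain ⟨f, hd, hf⟩ := hU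
  have hpart := fun i => @IsCompact.exists_finset_partition _ (Locality.constructibleTopology K)
    _ (hT i) D (fun x => {v : Locality K | g x ∈ v.ballAt (y i) (z i)})
    (fun x => Locality.isClopen_setOf_mem_ballAt (hz i) (g x))
    (fun v hv => mem_iUnion.2 (hloc i v hv))
  choose F hF hdisj hcover using hpart
  let ι := Σ i : Fin n, {P // P ∈ F i}
  let Q : ι → Set (Locality K) := fun k => k.2.1
  have hQS : ∀ k, Q k ⊆ S k.1 := fun k => (hF k.1 _ k.2.2).1
  have hQne : ∀ k, (Q k).Nonempty := fun k => (hF k.1 _ k.2.2).2.1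
  have hQc : ∀ k, @IsCompact _ (Locality.constructibleTopology K) (Q k) :=
    fun k => (hF k.1 _ k.2.2).2.2.1
  have hQx : ∀ k, ∃ x : D, g x ∈ Locality.ballOf (Q k) (y k.1) (z k.1) := fun k => by
    obtain ⟨x, hx⟩ := (hF k.1 _ k.2.2).2.2.2
    exact ⟨x, (Locality.mem_ballOf_iff_forall (hz k.1)).2 fun v hv => hx hv⟩
  choose p hp using hQx
  have hadm : ∀ k, ∀ v ∈ Q k, Locality.Admissible f t v := fun k v hv =>
    have h := hf k.1 v (hQS k hv)
    ⟨h.1, h.2.1, h.2.2.1, fun hv' => hS_nontrivial k.1 (hv' ▸ hQS k hv)⟩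
  have hun : ∀ k, Locality.AlmostUniform f t (Q k) ∧ Locality.UniformlyOpen (Q k) := by
    intro k
    -- Approximate zeros are excluded only for infinite `S_i`; pieces of a finite `S_i` enter as the
    -- finite part `T₂`.
    by_cases hfin : (S k.1).Finite
    · have hQfin := hfin.subset (hQS k)
      exact ⟨⟨∅, Q k, by simp, @isCompact_empty _ (Locality.constructibleTopology K), by simp,
        hQfin⟩, Locality.uniformlyOpen_of_finite hQfin fun v hv => (hadm k v hv).ne_trivial⟩
    · have hno : ∀ v ∈ Q k, Locality.CondNoApproxZero f t v := fun v hv =>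
        (hf k.1 v (hQS k hv)).2.2.2 hfin
      exact ⟨⟨Q k, ∅, by simp, hQc k, hno, finite_empty⟩,
        Locality.uniformlyOpen_of_condNoApproxZero ht hd (fun v hv => (hadm k v hv).leading) hno⟩
  have hQI : ∀ j k, j ≠ k → ∀ v ∈ Q j, ∀ w ∈ Q k, Locality.Independent v w := by
    intro j k hjk v hv w hw
    refine hI (mem_iUnion.2 ⟨_, hQS j hv⟩) (mem_iUnion.2 ⟨_, hQS k hw⟩) ?_
    rintro rfl
    obtain ⟨i, P, hP⟩ := j
    obtain ⟨i', P', hP'⟩ := k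
    by_cases hi : i = i'
    · subst hi
      refine Set.disjoint_left.1 (hdisj i P hP P' hP' fun h => hjk ?_) hv hw
      subst h
      rfl
    · exact Set.disjoint_left.1 (hS_disjoint hi) (hQS ⟨i, P, hP⟩ hv) (hQS ⟨i', P', hP'⟩ hw)
  -- Openness of `D` at a single locality of the piece is enough for membership in `D`; the
  -- condition on `g` uses the whole piece.
  have hnear : ∀ k, ∃ C : Finset K, (∀ x : Fin l → K,
      (∀ j, ∀ v ∈ Q k, Locality.Small C v (x j - (p k).1 j)) → x ∈ D) ∧ ∀ x : D,
      (∀ j, ∀ v ∈ Q k, Locality.Small C v (x.1 j - (p k).1 j)) →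
        g x ∈ Locality.ballOf (Q k) (y k.1) (z k.1) := by
    intro k
    obtain ⟨v, hv⟩ := hQne k
    obtain ⟨C, hC⟩ := (hD v (mem_iUnion.2 ⟨_, hQS k hv⟩)).exists_finset (p k).2
    have hsmall : ∀ C : Finset K, ∃ q : K, q ≠ 0 ∧ ∀ v ∈ Q k, Locality.Small C v q := by
      intro C
      obtain ⟨x, hx, hx', -⟩ := Locality.exists_large_small ht hd (hadm k) (B := ∅) (by simp)
        (hun k).1 (Locality.AlmostUniform.empty f t) (by simp) (hQne k) C
      exact ⟨x⁻¹, inv_ne_zero hx, fun v hv => (hx' v hv).inv hx⟩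
    obtain ⟨C', hC'⟩ := (hg k.1 (Q k) (hQS k) (hQne k)
      (Locality.isCompact_zariskiDual (hQc k))).exists_finset
      ((hun k).2.isOpen_ballOf hsmall (hz k.1)) (hp k)
    exact ⟨C ∪ C', fun x hx => hC x fun j => (hx j v hv).mono Finset.subset_union_left,
      fun x hx => hC' x fun j v hv => (hx j v hv).mono Finset.subset_union_right⟩
  choose C hCD hCg using hnear
  have happrox := fun j : Fin l => Locality.exists_approximation ht hd Q hadm
    (fun k => (hun k).1) hQne hQI (fun k => (p k).1 j) (Finset.univ.biUnion C)
  choose x hx using happrox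
  have hxC : ∀ k j, ∀ v ∈ Q k, Locality.Small (C k) v (x j - (p k).1 j) := fun k j v hv =>
    (hx j k v hv).mono (Finset.subset_biUnion_of_mem C (Finset.mem_univ k))
  -- Any one piece puts `x` in `D`, and one exists because `n > 0` and the `S_i` are nonempty.
  have hxD : x ∈ D := by
    obtain ⟨v, hv⟩ := hS_nonempty ⟨0, hn⟩
    obtain ⟨P, hP, -⟩ := hcover _ v hv
    exact hCD ⟨_, P, hP⟩ x (hxC _)
  refine ⟨⟨x, hxD⟩, fun i v hv => ?_⟩
  obtain ⟨P, hP, hvP⟩ := hcover i v hv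
  exact (Locality.mem_ballOf_iff_forall (hz i)).1 (hCg ⟨i, P, hP⟩ ⟨x, hxD⟩ (hxC _)) v hvP
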